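/- Let $k\ge 3$ and let $\Gamma=\Gamma(k)\subset \mathrm{SL}(2,\mathbb Z)$ be the principal congruence subgroup. Let $X^0=\mathcal H/\Gamma$, and let $\pi_\Gamma:\mathcal M^0=(\mathcal H\times\mathbb C)/(\Gamma\ltimes\mathbb Z^2)\to X^0$ be the modular family of elliptic curves, where $(\tau,z)$ is identified with $\left(\frac{a\tau+b}{c\tau+d},\frac{z+m+n\tau}{c\tau+d}\right)$ for $\begin{pmatrix}a&b\\c&d\end{pmatrix}\in\Gamma$ and $m,n\in\mathbb Z$. Let $\pi:\mathcal E\to B$ be a surjective holomorphic map from a compact connected complex surface to a compact connected Riemann surface, let $B^0\subset B$ be the set of points over which $\pi$ is a submersion, and let $\mathcal E^0=\pi^{-1}(B^0)$ be the union of the regular fibres. Assume that $\mathcal E$ is obtained through a classifying map, that is, there are a non-constant holomorphic map $f:B^0\to X^0$ and an isomorphism of $\mathcal E^0$ with the pullback $f^*\mathcal M^0$ over $B^0$. Let $f^\sharp:\mathcal E^0\to\mathcal M^0$ be the resulting map and let $O\subset\mathcal E^0$ be the preimage under $f^\sharp$ of the zero section $\{z=0\}$ of $\mathcal M^0$. Let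 $H_N:\mathcal E^0\setminus O\to\mathbb R$ be the function whose restriction to each regular fibre is the archimedean Néron local height. On $\mathbb C/(\mathbb Z+\mathbb Z\tau)$ with $x=\wp$, $2y=\wp'$ and $\Delta=g_2^3-27g_3^2$, this is the unique function that is continuous away from $0$, for which $H_N(P)-\tfrac12\log|x(P)|$ has a limit as $P\to 0$, and which satisfies $H_N(2P)=4H_N(P)-\log|2y(P)|+\tfrac14\log|\Delta|$ whenever $2P\ne 0$. Let $dd^c=\frac{i}{\pi}\partial\bar\partial$. For a local holomorphic equation $s=0$ of $O$, vanishing to first order along $O$, the function $H_N+\log|s|$ is locally integrable, and the currents $dd^c(H_N+\log|s|)$ for the various $s$ are the local expressions of the curvature current on $\mathcal E^0$ of the line bundle $\mathcal O(O)$ with the metric for which the canonical section has norm $e^{-H_N}$. The restriction of this current to a fibre is the curvature current of the restricted metric. The DeMarco–Mavraki current $T$ on $\mathcal E^0$ is the multiple by a real constant of this curvature current (so that $T$ is the same multiple of $dd^cH_N$ on $\mathcal E^0\setminus O$) whose restriction to every regular fibre is the normalized Haar measure. Let $\mu$ be the $(1,1)$-form on $\mathcal E^0$ that is the pullback by $f^\sharp$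 of the form on $\mathcal M^0$ induced by $i\partial\bar\partial\frac{(\operatorname{Im}z)^2}{\operatorname{Im}\tau}$ on $\mathcal H\times\mathbb C$. Locally on $\mathcal E^0$ let $\beta_1,\beta_2$ be Betti coordinates: for a local holomorphic lift $(\tau,z)$ of $f^\sharp$ to $\mathcal H\times\mathbb C$ they are the real functions with $z=\beta_1+\beta_2\tau$. **Theorem.** There is exactly one constant with this normalization property, so that $T$ is well defined. As currents on $\mathcal E^0$, $$T=\mu,\qquad\text{and consequently}\qquad T=d\beta_1\wedge d\beta_2 .$$ -/

import Mathlib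

open scoped Manifold ContDiff MatrixGroups Topology
open Set UpperHalfPlane MeasureTheory

noncomputable section

/-! ### Forms and currents on open subsets of complex vector spaces

A current of degree two on an open set `W` of a complex vector space `V` is a two-form with
distribution coefficients: to constant vector fields `v`, `w` and a test function `g` it assigns a
number, the value on `g` of its `(v, w)` coefficient. -/

section Currents

variable {V : Type*} [NormedAddCommGroup V] [NormedSpace ℂ V]

/-- The real one-form `i (∂bar - ∂) u`; at `x` it sends `v` to `- du_x (i v)`. -/
def conjDiff (u : V → ℝ) (x v : V) : ℝ :=
  -(fderiv ℝ u x (Complex.I • v))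

/-- The two-form `i ∂∂bar u`, that is, half the exterior derivative of `i (∂bar - ∂) u`. -/
def iddbar (u : V → ℝ) (x v w : V) : ℝ :=
  (fderiv ℝ (fun y => conjDiff u y w) x v - fderiv ℝ (fun y => conjDiff u y v) x w) / 2

/-- The two-form `dd^c u = (i / π) ∂∂bar u`. -/
def ddc (u : V → ℝ) (x v w : V) : ℝ :=
  iddbar u x v w / Real.pi

/-- The wedge product `da ∧ db` of the differentials of two real functions. -/
def wedgeDiff (a b : V → ℝ) (x v w : V) : ℝ :=
  fderiv ℝ a x v * fderiv ℝ b x w - fderiv ℝ a x w * fderiv ℝ b x v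

/-- `g` is a test function on `W`: smooth with compact support contained in `W`. -/
def IsTestFunction (W : Set V) (g : V → ℝ) : Prop :=
  ContDiff ℝ ∞ g ∧ HasCompactSupport g ∧ tsupport g ⊆ W

/-- The current `dd^c u` on `W` of a locally integrable function `u`: the second order operator
`dd^c` has constant coefficients, and it is moved to the test function. -/
def ddcCurrent [MeasureSpace V] (W : Set V) (u : V → ℝ) (v w : V) (g : V → ℝ) : ℝ :=
  ∫ x in W, u x * ddc g x v w

/-- The current on `W` given by a two-form `α`. -/
def formCurrent [MeasureSpace V] (W : Set V) (α : V → V → V → ℝ) (v w : V) (g : V → ℝ) : ℝ :=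
  ∫ x in W, α x v w * g x

/-- `s` is a holomorphic equation on `W` of the smooth hypersurface `Z`: it vanishes to order one
along `Z`, and nowhere else. -/
structure IsLocalEquation (W Z : Set V) (s : V → ℂ) : Prop where
  holo : DifferentiableOn ℂ s W
  zero_iff : ∀ x ∈ W, s x = 0 ↔ x ∈ Z
  order_one : ∀ x ∈ W, s x = 0 → fderiv ℂ s x ≠ 0

end Currents

/-! ### The form `μ` and the Betti coordinates on `ℍ × ℂ` -/

/-- The form `μ = i ∂∂bar ((Im z)² / Im τ)`, in the coordinates `(τ, z)`. -/
def muForm (p v w : ℂ × ℂ) : ℝ :=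
  iddbar (fun q : ℂ × ℂ => q.2.im ^ 2 / q.1.im) p v w

/-- The second of the Betti coordinates, the real numbers `β₁`, `β₂` with `z = β₁ + β₂ τ`. -/
def betti₂ (p : ℂ × ℂ) : ℝ := p.2.im / p.1.im

/-- The first of the Betti coordinates, the real numbers `β₁`, `β₂` with `z = β₁ + β₂ τ`. -/
def betti₁ (p : ℂ × ℂ) : ℝ := p.2.re - p.2.im / p.1.im * p.1.re

theorem betti_iff (p : ℂ × ℂ) (hp : 0 < p.1.im) (a b : ℝ) :
    p.2 = a + b * p.1 ↔ a = betti₁ p ∧ b = betti₂ p := by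
  have h : p.1.im ≠ 0 := hp.ne'
  rw [Complex.ext_iff]
  simp only [Complex.add_re, Complex.add_im, Complex.mul_re, Complex.mul_im, Complex.ofReal_re,
    Complex.ofReal_im, zero_mul, sub_zero, add_zero, zero_add, betti₁, betti₂]
  constructor
  · rintro ⟨h1, h2⟩
    have hb : b = p.2.im / p.1.im := by field_simp; linarith
    refine ⟨?_, hb⟩
    rw [← hb]; linarith
  · rintro ⟨rfl, rfl⟩
    constructor
    · ring
    · field_simp

/-! ### Modular curves and the modular families of elliptic curves -/

/-- The open modular curve `ℍ / Γ(k)`. -/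
abbrev OpenModularCurve (k : ℕ) : Type :=
  MulAction.orbitRel.Quotient (CongruenceSubgroup.Gamma k) ℍ

/-- The orbit relation of `Γ(k) ⋉ ℤ²` on `ℍ × ℂ`: the point `(τ, z)` is identified with
`((a τ + b) / (c τ + d), (z + m + n τ) / (c τ + d))`. -/
def ModularRel (k : ℕ) (p q : ℍ × ℂ) : Prop :=
  ∃ γ ∈ CongruenceSubgroup.Gamma k, ∃ m n : ℤ,
    q.1 = γ • p.1 ∧ q.2 = (p.2 + m + n * (p.1 : ℂ)) / denom γ p.1


theorem denom_int (γ : SL(2, ℤ)) (τ : ℍ) : denom γ τ = γ 1 0 * τ + γ 1 1 := by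
  simp [denom]

theorem coe_smul_mul_denom (γ : SL(2, ℤ)) (τ : ℍ) :
    ((γ • τ : ℍ) : ℂ) * denom γ τ = γ 0 0 * τ + γ 0 1 := by
  have hd : denom γ τ ≠ 0 := denom_ne_zero _ τ
  have h : ((γ • τ : ℍ) : ℂ) = (γ 0 0 * τ + γ 0 1) / denom γ τ := by
    rw [coe_specialLinearGroup_apply]; simp [denom]
  rw [h, div_mul_cancel₀ _ hd]

theorem denom_mul_int (δ γ : SL(2, ℤ)) (τ : ℍ) :
    denom ((δ * γ : SL(2, ℤ)) : GL (Fin 2) ℝ) τ = denom δ (γ • τ : ℍ) * denom γ τ := by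
  have h := coe_smul_mul_denom γ τ
  rw [denom_int δ, denom_int (δ * γ), add_mul, mul_assoc, h, denom_int γ]
  simp [Matrix.mul_apply, Fin.sum_univ_two]
  ring

theorem modularRel_equivalence (k : ℕ) : Equivalence (ModularRel k) where
  refl p := ⟨1, one_mem _, 0, 0, by simp, by simp⟩
  symm := by
    rintro ⟨τ, z⟩ ⟨τ', z'⟩ ⟨γ, hγ, m, n, h1, h2⟩
    dsimp only at h1 h2
    subst h1 h2
    have hd : denom γ τ ≠ 0 := denom_ne_zero _ τ
    have hc := denom_mul_int γ⁻¹ γ τ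
    rw [inv_mul_cancel] at hc
    have h1 : denom ((1 : SL(2, ℤ)) : GL (Fin 2) ℝ) τ = 1 := by rw [denom_int]; simp
    rw [h1] at hc
    have hdet : (γ 0 0 * γ 1 1 - γ 0 1 * γ 1 0 : ℂ) = 1 := by
      have := γ.det_coe
      rw [Matrix.det_fin_two] at this
      exact_mod_cast this
    refine ⟨γ⁻¹, inv_mem hγ, n * γ 0 1 - m * γ 0 0, m * γ 1 0 - n * γ 1 1, by simp, ?_⟩
    have hi : denom ((γ⁻¹ : SL(2, ℤ)) : GL (Fin 2) ℝ) (γ • τ : ℍ) = (denom γ τ)⁻¹ :=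
      eq_inv_of_mul_eq_one_left hc.symm
    have hs := coe_smul_mul_denom γ τ
    have hm := denom_int γ τ
    dsimp only
    rw [hi, div_inv_eq_mul, add_mul, add_mul, div_mul_cancel₀ _ hd, mul_assoc, hs, hm]
    push_cast
    linear_combination (m + n * τ : ℂ) * hdet
  trans := by
    rintro ⟨τ, z⟩ ⟨τ', z'⟩ ⟨τ'', z''⟩ ⟨γ, hγ, m, n, h1, h2⟩ ⟨δ, hδ, m', n', h3, h4⟩
    dsimp only at h1 h2 h3 h4
    subst h1 h2 h3 h4
    have hd : denom γ τ ≠ 0 := denom_ne_zero _ τ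
    refine ⟨δ * γ, mul_mem hδ hγ, m + m' * γ 1 1 + n' * γ 0 1, n + m' * γ 1 0 + n' * γ 0 0,
      (mul_smul _ _ _).symm, ?_⟩
    have hs := coe_smul_mul_denom γ τ
    have hm := denom_int γ τ
    dsimp only
    rw [denom_mul_int, ← mul_div_mul_right _ _ hd, add_mul, add_mul, div_mul_cancel₀ _ hd,
      mul_assoc (n' : ℂ), hs]
    congr 1
    push_cast
    rw [hm]
    ring

/-- The open modular elliptic surface `(ℍ × ℂ) / (Γ(k) ⋉ ℤ²)`. -/
def ModularFamily (k : ℕ) : Type :=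
  Quotient (⟨ModularRel k, modularRel_equivalence k⟩ : Setoid (ℍ × ℂ))

/-- The quotient map `ℍ → ℍ / Γ(k)`. -/
def OpenModularCurve.mk (k : ℕ) (τ : ℍ) : OpenModularCurve k :=
  Quotient.mk _ τ

namespace ModularFamily

/-- The quotient map `ℍ × ℂ → (ℍ × ℂ) / (Γ(k) ⋉ ℤ²)`. -/
def mk (k : ℕ) (p : ℍ × ℂ) : ModularFamily k :=
  Quotient.mk _ p

/-- The projection of the modular family to the open modular curve. -/
def proj (k : ℕ) : ModularFamily k → OpenModularCurve k :=
  Quotient.lift (fun p => OpenModularCurve.mk k p.1) (by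
    rintro p q ⟨γ, hγ, m, n, h1, h2⟩
    refine (Quotient.sound ?_).symm
    exact ⟨⟨γ, hγ⟩, h1.symm⟩)

/-- The zero section of the modular family. -/
def zeroSection (k : ℕ) : Set (ModularFamily k) :=
  range fun τ : ℍ => mk k (τ, 0)

end ModularFamily

/-! ### The Néron local height -/

/-- The pair of periods `1`, `τ`. -/
def periodPair (τ : ℍ) : PeriodPair where
  ω₁ := 1
  ω₂ := τ
  indep := by
    refine LinearIndependent.pair_iff.2 fun s t h => ?_
    have hi := congrArg Complex.im h
    have hr := congrArg Complex.re h
    have ht : t = 0 := by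
      simpa [τ.im_ne_zero, τ.im_pos.ne'] using hi
    subst ht
    exact ⟨by simpa using hr, rfl⟩

/-- The discriminant `g₂³ - 27 g₃²` of the Weierstrass equation `y² = x³ - (g₂ / 4) x - g₃ / 4`
of the elliptic curve `ℂ / (ℤ + ℤ τ)`, where `x = ℘` and `2 y = ℘'`. -/
def latticeDiscr (τ : ℍ) : ℂ :=
  (periodPair τ).g₂ ^ 3 - 27 * (periodPair τ).g₃ ^ 2

/-- `h` is the archimedean Néron local height function of the elliptic curve `ℂ / (ℤ + ℤ τ)`,
written as a periodic function on `ℂ`: it is continuous away from the origin `O`,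
`h(P) - log |x(P)| / 2` has a limit as `P` tends to `O`, and
`h(2 P) = 4 h(P) - log |2 y(P)| + log |Δ| / 4` whenever `2 P` is not `O`. -/
structure IsNeronHeight (τ : ℍ) (h : ℂ → ℝ) : Prop where
  periodic : ∀ z, ∀ l ∈ (periodPair τ).lattice, h (z + l) = h z
  continuousOn : ContinuousOn h {z | z ∉ (periodPair τ).lattice}
  limit : ∃ c : ℝ, Filter.Tendsto
    (fun z => h z - Real.log ‖(periodPair τ).weierstrassP z‖ / 2) (𝓝[≠] 0) (𝓝 c)
  duplication : ∀ z, 2 * z ∉ (periodPair τ).lattice →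
    h (2 * z) = 4 * h z - Real.log ‖(periodPair τ).derivWeierstrassP z‖
      + Real.log ‖latticeDiscr τ‖ / 4

/-- The Néron local height function of `ℂ / (ℤ + ℤ τ)`: the only function with the properties
above, up to its irrelevant value at the origin. -/
def neronHeight (τ : ℍ) : ℂ → ℝ :=
  Classical.epsilon (IsNeronHeight τ)

/-- The Néron local height on the fibres of the modular family. -/
def ModularFamily.neronHeight {k : ℕ} (m : ModularFamily k) : ℝ :=
  _root_.neronHeight (Quotient.out m).1 (Quotient.out m).2

/-- The normalized Haar measure of `ℂ / (ℤ + ℤ τ)`, lifted to `ℂ`: the translation-invariant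
measure for which a period parallelogram, whose area is `Im τ`, has mass one. -/
def fibreHaar (τ : ℍ) : Measure ℂ :=
  (ENNReal.ofReal τ.im)⁻¹ • volume

/-! ### Elliptic surfaces with a classifying map -/

section Surfaces

variable {B E : Type*} [TopologicalSpace B] [ChartedSpace ℂ B]
  [TopologicalSpace E] [ChartedSpace (ℂ × ℂ) E]

/-- The set `B⁰` of points over which the fibre of `π` is regular. -/
def regularBase (π : E → B) : Set B :=
  {b | ∀ e, π e = b → Function.Surjective (mfderiv 𝓘(ℂ, ℂ × ℂ) 𝓘(ℂ) π e)}

/-- The union `E⁰` of the regular fibres of `π`. -/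
def regularPart (π : E → B) : Set E :=
  π ⁻¹' regularBase π

/-- A classifying map of `π : E → B` into the modular curve of level `k`: a non-constant
holomorphic map `f : B⁰ → ℍ / Γ(k)`, together with an isomorphism of `E⁰` with the pullback by `f`
of the modular family, given by a map `fSharp` from `E⁰` to the modular family.
The functions `f` and `fSharp` have arbitrary values outside of `B⁰` and `E⁰`.
A map into a quotient of `ℍ` or of `ℍ × ℂ` is holomorphic if it lifts locally to a holomorphic
map. -/
structure ClassifyingMap (k : ℕ) (π : E → B) where
  f : B → OpenModularCurve k
  nonconstant : ∃ b ∈ regularBase π, ∃ b' ∈ regularBase π, f b ≠ f b'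
  f_holo : ∀ b ∈ regularBase π, ∃ U : Set B, IsOpen U ∧ b ∈ U ∧ ∃ τ : B → ℍ,
    MDifferentiableOn 𝓘(ℂ) 𝓘(ℂ) (fun x => (τ x : ℂ)) U ∧
    ∀ x ∈ U, f x = OpenModularCurve.mk k (τ x)
  fSharp : E → ModularFamily k
  fSharp_holo : ∀ e ∈ regularPart π, ∃ U : Set E, IsOpen U ∧ e ∈ U ∧ ∃ F : E → ℍ × ℂ,
    MDifferentiableOn 𝓘(ℂ, ℂ × ℂ) 𝓘(ℂ) (fun x => ((F x).1 : ℂ)) U ∧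
    MDifferentiableOn 𝓘(ℂ, ℂ × ℂ) 𝓘(ℂ) (fun x => (F x).2) U ∧
    ∀ x ∈ U, fSharp x = ModularFamily.mk k (F x)
  /-- The pair `(π, fSharp)` maps `E⁰` to the fibre product. -/
  proj_fSharp : ∀ e ∈ regularPart π, ModularFamily.proj k (fSharp e) = f (π e)
  /-- The map from `E⁰` to the fibre product is bijective. -/
  bijective : ∀ b ∈ regularBase π, ∀ m, ModularFamily.proj k m = f b →
    ∃! e, π e = b ∧ fSharp e = m
  /-- Its inverse is holomorphic: for a local lift `τ` of `f` to `ℍ`, on an open set `U`, the fibre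
  product has the covering `(b, z) ↦ (b, [τ b, z])` by `U × ℂ`, and the composition with this
  covering is holomorphic. -/
  inverse_holo : ∀ (U : Set B) (τ : B → ℍ), IsOpen U → U ⊆ regularBase π →
    MDifferentiableOn 𝓘(ℂ) 𝓘(ℂ) (fun x => (τ x : ℂ)) U →
    (∀ x ∈ U, f x = OpenModularCurve.mk k (τ x)) →
    ∃ g : B × ℂ → E,
      MDifferentiableOn (𝓘(ℂ).prod 𝓘(ℂ)) 𝓘(ℂ, ℂ × ℂ) g (U ×ˢ univ) ∧
      ∀ b ∈ U, ∀ z, π (g (b, z)) = b ∧ fSharp (g (b, z)) = ModularFamily.mk k (τ b, z)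

namespace ClassifyingMap

variable {k : ℕ} {π : E → B} (C : ClassifyingMap k π)

/-- The zero section of `E⁰`. -/
def zeroSection : Set E :=
  {e | e ∈ regularPart π ∧ C.fSharp e ∈ ModularFamily.zeroSection k}

/-- The Néron local height function `H_N` on the regular fibres. -/
def neronHeight (e : E) : ℝ :=
  (C.fSharp e).neronHeight

/-- `F` is a branch of the elliptic logarithm over the domain of the holomorphic chart `φ` of `E⁰`,
written in the chart: a holomorphic lift of `fSharp` to `ℍ × ℂ`. -/
structure IsEllipticLog (φ : OpenPartialHomeomorph E (ℂ × ℂ)) (F : ℂ × ℂ → ℂ × ℂ) : Prop where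
  holo : DifferentiableOn ℂ F φ.target
  lift : ∀ x ∈ φ.target, ∃ h : 0 < (F x).1.im,
    C.fSharp (φ.symm x) = ModularFamily.mk k (⟨(F x).1, h⟩, (F x).2)

/-- The form `μ` on `E⁰`, the pullback of the form `μ` of the modular family, in a chart with
elliptic logarithm `F`. -/
def pullbackMu (F : ℂ × ℂ → ℂ × ℂ) (x v w : ℂ × ℂ) : ℝ :=
  muForm (F x) (fderiv ℝ F x v) (fderiv ℝ F x w)

/-- The function `H_N + log |s|` on a chart, where `s` is a local equation of the zero section.
It is minus the logarithm of the norm of a local frame of the line bundle of the zero section, for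
the metric in which the canonical section has norm `exp (-H_N)`. -/
def potential (φ : OpenPartialHomeomorph E (ℂ × ℂ)) (s : ℂ × ℂ → ℂ) (x : ℂ × ℂ) : ℝ :=
  C.neronHeight (φ.symm x) + Real.log ‖s x‖

/-- The curvature current of the line bundle of the zero section, metrized by the Néron local
height, becomes the normalized Haar measure on every regular fibre when it is multiplied by `c`.
The fibre over `b` is parametrized by `u : ℂ → E`, and the restriction of the current to the fibre
is the curvature current of the restricted metric. -/
def IsNormalizing (c : ℝ) : Prop :=
  ∀ b ∈ regularBase π, ∀ (τ : ℍ) (u : ℂ → E),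
    (∀ z, π (u z) = b ∧ C.fSharp (u z) = ModularFamily.mk k (τ, z)) →
    ∀ (W : Set ℂ) (s : ℂ → ℂ), IsOpen W → IsLocalEquation W (u ⁻¹' C.zeroSection) s →
    ∀ g : ℂ → ℝ, IsTestFunction W g →
      c * ddcCurrent W (fun z => C.neronHeight (u z) + Real.log ‖s z‖) 1 Complex.I g =
        ∫ z, g z ∂fibreHaar τ

/-- The normalizing constant. -/
def normalizingConstant : ℝ :=
  Classical.epsilon C.IsNormalizing

/-- The DeMarco–Mavraki current `T` on `E⁰`: away from the zero section it is a constant multiple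
of `dd^c H_N`, across the zero section it is the same multiple of the curvature current
`dd^c (H_N + log |s|)`, where `s` is a local equation of the zero section, and it restricts to the
normalized Haar measure on every regular fibre. It is written in a chart `φ` of `E⁰`. -/
def deMarcoMavrakiCurrent (φ : OpenPartialHomeomorph E (ℂ × ℂ)) (s : ℂ × ℂ → ℂ)
    (v w : ℂ × ℂ) (g : ℂ × ℂ → ℝ) : ℝ :=
  C.normalizingConstant * ddcCurrent φ.target (C.potential φ s) v w g

end ClassifyingMap

end Surfaces

end

/-! Everything rests on an explicit formula for the Néron height. Let `oddTheta` be the odd theta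
function, written as a product in q = e(τ), and let Θ = `normalizedTheta` be its multiple by
e(τ/12). Off the zero section, H_N = π (Im z)² / Im τ - log |Θ(τ, z)|. Since Θ is holomorphic in (τ,
z) and vanishes to first order along the zero section, s/Θ is holomorphic without zeros for every
local equation s. Hence H_N + log |s| is almost everywhere the smooth function π (Im z)² / Im τ +
log |s/Θ|. Its second summand is pluriharmonic, so dd^c = (i/π) ∂∂bar gives exactly μ
(`potential_current`). On a fibre μ has density 1 / Im τ, the normalized Haar measure, so the
normalizing constant is 1. The identity μ = dβ₁ ∧ dβ₂ is a direct computation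
(`muForm_eq_wedgeDiff`).

The formula holds because its right side satisfies the axioms of the height and these axioms have
one solution. Duplication reduces to ℘'(z) θ(z)⁴ = -θ'(0)³ θ(2z)
(`derivWeierstrassP_mul_oddTheta_pow`), which follows from Liouville's theorem, and to |Δ| = |q|
|θ'(0)|¹² (`norm_latticeDiscr`), which follows from the product for the discriminant. For
uniqueness, the difference of two solutions is bounded and is multiplied by 4 under doubling.
Uniqueness also makes the height invariant under SL(2, ℤ), so no transformation law of theta
functions is needed.

On the surface it must still be shown that Θ composed with a branch F of the elliptic logarithm
vanishes only to first order. This is read off by restricting to a fibre and comparing the two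
expressions for the height there. -/

noncomputable section

/-! ### Holomorphic functions of several variables: smoothness, limits, division by a simple
equation. -/

section SeveralVariables

variable {V : Type*} [NormedAddCommGroup V] [NormedSpace ℂ V]

theorem norm_fderiv_le_of_forall_ball_norm_le {f : V → ℂ} {x : V} {r M : ℝ} (hr : 0 < r)
    (hf : DifferentiableOn ℂ f (Metric.ball x r)) (hM : ∀ y ∈ Metric.ball x r, ‖f y‖ ≤ M) :
    ‖fderiv ℂ f x‖ ≤ 2 * M / r := by
  refine Complex.norm_fderiv_le_div_of_mapsTo_ball hf (fun y hy => ?_) hr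
  rw [mem_closedBall_iff_norm]
  calc ‖f y - f x‖ ≤ ‖f y‖ + ‖f x‖ := norm_sub_le _ _
    _ ≤ 2 * M := by linarith [hM y hy, hM x (Metric.mem_ball_self hr)]

theorem exists_ball_smul_mem {W : Set V} (hW : IsOpen W) {x : V} (hx : x ∈ W) (v : V) :
    ∃ R > 0, ∃ ε > 0, ∀ y ∈ Metric.ball x ε, ∀ t ∈ Metric.closedBall (0 : ℂ) R, y + t • v ∈ W := by
  obtain ⟨ε, hε, h⟩ := Metric.isOpen_iff.1 hW x hx
  refine ⟨ε / 2 / (‖v‖ + 1), by positivity, ε / 2, by positivity, fun y hy t ht => h ?_⟩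
  rw [mem_closedBall_zero_iff, le_div_iff₀ (by positivity)] at ht
  rw [Metric.mem_ball, dist_eq_norm] at hy ⊢
  calc ‖y + t • v - x‖ = ‖(y - x) + t • v‖ := by congr 1; abel
    _ ≤ ‖y - x‖ + ‖t‖ * ‖v‖ := (norm_add_le _ _).trans_eq (by rw [norm_smul])
    _ < ε := by nlinarith [norm_nonneg t]

theorem DifferentiableAt.div_complex {s₁ s₂ : V → ℂ} {x : V} (h1 : DifferentiableAt ℂ s₁ x)
    (h2 : DifferentiableAt ℂ s₂ x) (h : s₂ x ≠ 0) : DifferentiableAt ℂ (fun y => s₁ y / s₂ y) x := by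
  simp_rw [div_eq_mul_inv]
  exact h1.mul (h2.inv h)

variable [FiniteDimensional ℂ V]

/-- Differentiation under the integral sign, with the derivative dominated by Cauchy's estimate on a
compact neighbourhood of the translated circle. It makes Cauchy integrals along a direction `v`
holomorphic in the base point, both for derivatives and for quotients. -/
theorem differentiableAt_circleIntegral_translate {W : Set V} (hW : IsOpen W) {f : V → ℂ}
    (hf : DifferentiableOn ℂ f W) {k : ℂ → ℂ} {R : ℝ} (hR : 0 ≤ R)
    (hk : ContinuousOn k (Metric.sphere 0 R)) {x v : V}
    (hx : ∀ t ∈ Metric.sphere (0 : ℂ) R, x + t • v ∈ W) :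
    DifferentiableAt ℂ (fun y => ∮ t in C(0, R), k t * f (y + t • v)) x := by
  have : ProperSpace V := FiniteDimensional.proper ℂ V
  borelize V
  set K : Set V := (fun t : ℂ => x + t • v) '' Metric.sphere 0 R with hK
  have hKc : IsCompact K := (isCompact_sphere (0 : ℂ) R).image (by fun_prop)
  have hKW : K ⊆ W := by rintro _ ⟨t, ht, rfl⟩; exact hx t ht
  obtain ⟨δ, hδ, hδW⟩ := hKc.exists_cthickening_subset_open hW hKW
  have hcpt : IsCompact (Metric.cthickening δ K) := hKc.cthickening
  obtain ⟨M, hM⟩ := hcpt.exists_bound_of_continuousOn (hf.continuousOn.mono hδW)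
  obtain ⟨N, hN⟩ := (isCompact_sphere (0 : ℂ) R).exists_bound_of_continuousOn hk
  have hball : ∀ y ∈ Metric.ball x (δ / 2), ∀ t ∈ Metric.sphere (0 : ℂ) R,
      Metric.ball (y + t • v) (δ / 2) ⊆ Metric.cthickening δ K := by
    intro y hy t ht p hp
    refine Metric.mem_cthickening_of_dist_le p (x + t • v) δ K ⟨t, ht, rfl⟩ ?_
    rw [Metric.mem_ball] at hy hp
    calc dist p (x + t • v) ≤ dist p (y + t • v) + dist (y + t • v) (x + t • v) :=
          dist_triangle _ _ _
      _ ≤ δ := by rw [dist_add_right]; linarith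
  have hdiff : ∀ y ∈ Metric.ball x (δ / 2), ∀ t ∈ Metric.sphere (0 : ℂ) R,
      DifferentiableAt ℂ f (y + t • v) := fun y hy t ht =>
    hf.differentiableAt (hW.mem_nhds (hδW (hball y hy t ht (Metric.mem_ball_self (by positivity)))))
  have hmem : ∀ θ : ℝ, circleMap 0 R θ ∈ Metric.sphere (0 : ℂ) R := circleMap_mem_sphere 0 hR
  have hkc : Continuous fun θ : ℝ => k (circleMap 0 R θ) :=
    hk.comp_continuous (continuous_circleMap 0 R) hmem
  have hcont : ∀ y ∈ Metric.ball x (δ / 2), Continuous fun θ : ℝ =>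
      deriv (circleMap 0 R) θ • (k (circleMap 0 R θ) * f (y + circleMap 0 R θ • v)) := by
    intro y hy
    have h2 : Continuous fun θ : ℝ => f (y + circleMap 0 R θ • v) := by
      rw [continuous_iff_continuousAt]
      intro θ
      exact (hdiff y hy _ (hmem θ)).continuousAt.comp
        (f := fun θ : ℝ => y + circleMap 0 R θ • v) (by fun_prop)
    simp only [deriv_circleMap, smul_eq_mul]
    exact ((continuous_circleMap 0 R).mul continuous_const).mul (hkc.mul h2)
  have key := intervalIntegral.hasFDerivAt_integral_of_dominated_of_fderiv_le
    (𝕜 := ℂ) (μ := volume) (a := 0) (b := 2 * Real.pi) (s := Metric.ball x (δ / 2)) (x₀ := x)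
    (F := fun y θ => deriv (circleMap 0 R) θ • (k (circleMap 0 R θ) *
      f (y + circleMap 0 R θ • v)))
    (F' := fun y θ => (deriv (circleMap 0 R) θ * k (circleMap 0 R θ)) •
      fderiv ℂ f (y + circleMap 0 R θ • v))
    (bound := fun _ => R * N * (2 * M / (δ / 2)))
    (Metric.ball_mem_nhds x (by positivity)) ?_ ?_ ?_ ?_ ?_ ?_
  · exact key.differentiableAt
  · filter_upwards [Metric.ball_mem_nhds x (by positivity : 0 < δ / 2)] with y hy
    exact (hcont y hy).aestronglyMeasurable
  · exact (hcont x (Metric.mem_ball_self (by positivity))).intervalIntegrable _ _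
  · have h1 : Measurable fun θ : ℝ => fderiv ℂ f (x + circleMap 0 R θ • v) :=
      (measurable_fderiv ℂ f).comp (by fun_prop : Continuous fun θ : ℝ =>
        x + circleMap 0 R θ • v).measurable
    have : ProperSpace (V →L[ℂ] ℂ) := FiniteDimensional.proper ℂ _
    have h2 : Continuous fun θ : ℝ => deriv (circleMap 0 R) θ * k (circleMap 0 R θ) := by
      simp only [deriv_circleMap]
      exact ((continuous_circleMap 0 R).mul continuous_const).mul hkc
    exact (h2.stronglyMeasurable.smul h1.stronglyMeasurable).aestronglyMeasurable
  · refine Filter.Eventually.of_forall fun θ _ y hy => ?_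
    rw [norm_smul, norm_mul]
    have h1 : ‖deriv (circleMap 0 R) θ‖ = R := by simp [abs_of_nonneg hR]
    have h2 := hN _ (hmem θ)
    have h3 := norm_fderiv_le_of_forall_ball_norm_le (f := f) (x := y + circleMap 0 R θ • v)
      (M := M) (half_pos hδ) (hf.mono ((hball y hy _ (hmem θ)).trans hδW))
      (fun p hp => hM p (hball y hy _ (hmem θ) hp))
    rw [h1]
    have h4 : 0 ≤ N := (norm_nonneg _).trans h2
    gcongr
  · exact intervalIntegrable_const
  · refine Filter.Eventually.of_forall fun θ _ y hy => ?_
    have h1 := (hdiff y hy _ (hmem θ)).hasFDerivAt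
    have h2 : HasFDerivAt (fun y : V => f (y + circleMap 0 R θ • v))
        (fderiv ℂ f (y + circleMap 0 R θ • v)) y := by
      rwa [hasFDerivAt_comp_add_right]
    have h3 := h2.const_smul (deriv (circleMap 0 R) θ * k (circleMap 0 R θ))
    refine h3.congr_of_eventuallyEq (Filter.Eventually.of_forall fun y => ?_)
    simp [mul_assoc]

/-- Cauchy's formula on the line through y in direction `v` writes the directional derivative as
(2πi)⁻¹ ∮ t⁻² f(y + tv) dt, which is holomorphic in y. -/
theorem DifferentiableOn.differentiableOn_fderiv_apply {W : Set V} (hW : IsOpen W) {f : V → ℂ}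
    (hf : DifferentiableOn ℂ f W) (v : V) : DifferentiableOn ℂ (fun y => fderiv ℂ f y v) W := by
  intro x hx
  obtain ⟨R, hR, ε, hε, h⟩ := exists_ball_smul_mem hW hx v
  have hd := differentiableAt_circleIntegral_translate hW hf (k := fun t => (t ^ 2)⁻¹) hR.le
    (ContinuousOn.inv₀ (by fun_prop) fun t ht => by
      have : ‖t‖ = R := by simpa using ht
      have : t ≠ 0 := by rintro rfl; simp at this; exact hR.ne this
      positivity)
    (x := x) (v := v) (fun t ht => h x (Metric.mem_ball_self hε) t (Metric.sphere_subset_closedBall ht))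
  refine DifferentiableAt.differentiableWithinAt ?_
  refine (hd.const_mul ((2 * Real.pi * Complex.I : ℂ)⁻¹)).congr_of_eventuallyEq ?_
  filter_upwards [Metric.ball_mem_nhds x hε] with y hy
  have hyW : y ∈ W := by simpa using h y hy 0 (by simp [hR.le])
  have hline : ∀ t ∈ Metric.closedBall (0 : ℂ) R, HasDerivAt (fun t : ℂ => f (y + t • v))
      (fderiv ℂ f (y + t • v) v) t := by
    intro t ht
    have h1 := (hf.differentiableAt (hW.mem_nhds (h y hy t ht))).hasFDerivAt
    have h2 : HasDerivAt (fun t : ℂ => y + t • v) v t := by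
      simpa using ((hasDerivAt_id t).smul_const v).const_add y
    exact h1.comp_hasDerivAt t h2
  have h0 := hline 0 (by simp [hR.le])
  simp only [zero_smul, add_zero] at h0
  have hc : DiffContOnCl ℂ (fun t : ℂ => f (y + t • v)) (Metric.ball 0 R) := by
    refine DifferentiableOn.diffContOnCl fun t ht => ?_
    rw [closure_ball _ hR.ne'] at ht
    exact (hline t ht).differentiableAt.differentiableWithinAt
  have h3 := hc.circleIntegral_one_div_sub_center_pow_smul hR 1
  simp only [Nat.factorial_one, Nat.cast_one, div_one, iteratedDeriv_one, h0.deriv, sub_zero,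
    one_div, smul_eq_mul, Nat.reduceAdd] at h3
  rw [h3, inv_mul_cancel_left₀ Complex.two_pi_I_ne_zero]

theorem DifferentiableOn.contDiffOn_complex {W : Set V} (hW : IsOpen W) {f : V → ℂ}
    (hf : DifferentiableOn ℂ f W) : ContDiffOn ℂ ∞ f W := by
  rw [contDiffOn_infty]
  intro n
  induction n generalizing f with
  | zero => simpa using hf.continuousOn
  | succ n ih =>
    rw [Nat.cast_succ, contDiffOn_succ_iff_fderiv_of_isOpen hW]
    refine ⟨hf, by simp, ?_⟩
    rw [contDiffOn_clm_apply]
    exact fun v => ih (hf.differentiableOn_fderiv_apply hW v)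

/-- Weierstrass's theorem: by Cauchy's estimate, uniform convergence on a ball makes the derivatives
uniformly Cauchy on the ball of half the radius. -/
theorem TendstoLocallyUniformlyOn.differentiableOn_complex {ι : Type*} {l : Filter ι} [l.NeBot]
    {W : Set V} (hW : IsOpen W) {f : ι → V → ℂ} {g : V → ℂ}
    (h : TendstoLocallyUniformlyOn f g l W) (hf : ∀ n, DifferentiableOn ℂ (f n) W) :
    DifferentiableOn ℂ g W := by
  intro x hx
  obtain ⟨ρ, hρ, hρW, hu⟩ : ∃ ρ > 0, Metric.ball x ρ ⊆ W ∧
      TendstoUniformlyOn f g l (Metric.ball x ρ) := by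
    have := FiniteDimensional.proper ℂ V
    obtain ⟨ρ, hρ, h1⟩ := Metric.nhds_basis_closedBall.mem_iff.1 (hW.mem_nhds hx)
    exact ⟨ρ, hρ, Metric.ball_subset_closedBall.trans h1,
      ((tendstoLocallyUniformlyOn_iff_forall_isCompact hW).1 h _ h1
        (isCompact_closedBall x ρ)).mono Metric.ball_subset_closedBall⟩
  have hsub : ∀ y ∈ Metric.ball x (ρ / 2), Metric.ball y (ρ / 2) ⊆ Metric.ball x ρ := by
    intro y hy p hp
    rw [Metric.mem_ball] at hy hp ⊢
    linarith [dist_triangle p y x]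
  have hd : ∀ n, ∀ y ∈ Metric.ball x ρ, DifferentiableAt ℂ (f n) y := fun n y hy =>
    (hf n).differentiableAt (hW.mem_nhds (hρW hy))
  have hC : UniformCauchySeqOn (fun n => fderiv ℂ (f n)) l (Metric.ball x (ρ / 2)) := by
    have hc := hu.uniformCauchySeqOn
    intro S hS
    obtain ⟨ε, hε, hεS⟩ := Metric.mem_uniformity_dist.1 hS
    filter_upwards [hc _ (Metric.dist_mem_uniformity (by positivity : 0 < ε * ρ / 8))] with m hm y hy
    refine hεS ?_
    rw [dist_eq_norm, ← fderiv_fun_sub (hd _ y (Metric.ball_subset_ball (by linarith) hy))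
      (hd _ y (Metric.ball_subset_ball (by linarith) hy))]
    refine (norm_fderiv_le_of_forall_ball_norm_le (M := ε * ρ / 8) (half_pos hρ)
      (fun p hp => ((hd _ p (hsub y hy hp)).sub (hd _ p (hsub y hy hp))).differentiableWithinAt)
      (fun p hp => ?_)).trans_lt ?_
    · have := hm p (hsub y hy hp)
      simp only [dist_eq_norm] at this
      exact this.le
    · rw [div_lt_iff₀ (by positivity)]
      nlinarith [mul_pos hε hρ]
  have hlim : ∀ y ∈ Metric.ball x (ρ / 2), ∃ L, Filter.Tendsto (fun n => fderiv ℂ (f n) y) l (𝓝 L) := by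
    intro y hy
    exact CompleteSpace.complete (hC.cauchy_map hy)
  choose! g' hg' using hlim
  have hU := hC.tendstoUniformlyOn_of_tendsto hg'
  have hx' : x ∈ Metric.ball x (ρ / 2) := Metric.mem_ball_self (by positivity)
  refine (hasFDerivAt_of_tendstoUniformlyOn (f := f) Metric.isOpen_ball hU (fun n y hy => ?_)
    (fun y hy => ?_) hx').differentiableAt.differentiableWithinAt
  · exact (hd n y (Metric.ball_subset_ball (by linarith) hy)).hasFDerivAt
  · exact hu.tendsto_at (Metric.ball_subset_ball (by linarith) hy)


theorem differentiableOn_quotient_of_simple_zeros {U : Set ℂ} (hU : IsOpen U) {A B : ℂ → ℂ}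
    (hA : DifferentiableOn ℂ A U) (hB : DifferentiableOn ℂ B U)
    (h : ∀ t ∈ U, B t = 0 → A t = 0 ∧ deriv B t ≠ 0) :
    DifferentiableOn ℂ (fun t => if B t = 0 then deriv A t / deriv B t else A t / B t) U := by
  intro t ht
  refine DifferentiableAt.differentiableWithinAt ?_
  have hUt := hU.mem_nhds ht
  by_cases hBt : B t = 0
  · obtain ⟨hAt, hB'⟩ := h t ht hBt
    have hdA : DifferentiableAt ℂ (dslope A t) t :=
      ((Complex.differentiableOn_dslope hUt).2 hA).differentiableAt hUt
    have hdB : DifferentiableAt ℂ (dslope B t) t :=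
      ((Complex.differentiableOn_dslope hUt).2 hB).differentiableAt hUt
    have hne : dslope B t t ≠ 0 := by rwa [dslope_same]
    refine (hdA.div hdB hne).congr_of_eventuallyEq ?_
    filter_upwards [hdB.continuousAt.eventually_ne hne] with y hy
    by_cases hyt : y = t
    · subst hyt; simp [hBt]
    · have e1 : A y = (y - t) * dslope A t y := by
        have := sub_smul_dslope A t y
        simpa [hAt] using this.symm
      have e2 : B y = (y - t) * dslope B t y := by
        have := sub_smul_dslope B t y
        simpa [hBt] using this.symm
      have hyt' : y - t ≠ 0 := sub_ne_zero.2 hyt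
      rw [if_neg (by rw [e2]; exact mul_ne_zero hyt' hy), Pi.div_apply, e1, e2,
        mul_div_mul_left _ _ hyt']
  · refine ((hA.differentiableAt hUt).div (hB.differentiableAt hUt) hBt).congr_of_eventuallyEq ?_
    filter_upwards [(hB.differentiableAt hUt).continuousAt.eventually_ne hBt] with y hy
    simp [hy]

/-- In a direction `v` transverse to the zero set of s₂, the quotient s₁/s₂ has only removable
singularities on each nearby line. Cauchy's formula on a circle avoiding the zeros recovers its
value at the centre, and the integral depends holomorphically on the centre. -/
theorem exists_local_quotient {W : Set V} (hW : IsOpen W) {s₁ s₂ : V → ℂ}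
    (h1 : DifferentiableOn ℂ s₁ W) (h2 : DifferentiableOn ℂ s₂ W)
    (h12 : ∀ x ∈ W, s₂ x = 0 → s₁ x = 0) {x : V} (hx : x ∈ W)
    (hd : s₂ x = 0 → fderiv ℂ s₂ x ≠ 0) :
    ∃ r : V → ℂ, ∀ᶠ y in 𝓝 x, DifferentiableAt ℂ r y ∧ s₁ y = s₂ y * r y := by
  by_cases hs : s₂ x = 0
  swap
  · refine ⟨fun y => s₁ y / s₂ y, ?_⟩
    have hc := (h2.differentiableAt (hW.mem_nhds hx)).continuousAt
    filter_upwards [hW.mem_nhds hx, hc.eventually_ne hs] with y hy hy0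
    exact ⟨(h1.differentiableAt (hW.mem_nhds hy)).div_complex (h2.differentiableAt (hW.mem_nhds hy)) hy0,
      by field_simp⟩
  obtain ⟨v, hv⟩ : ∃ v, fderiv ℂ s₂ x v ≠ 0 := by
    by_contra! hcon
    exact hd hs (by ext v; simpa using hcon v)
  set W₁ : Set V := {y | y ∈ W ∧ fderiv ℂ s₂ y v ≠ 0} with hW₁
  have hW₁o : IsOpen W₁ :=
    (h2.differentiableOn_fderiv_apply hW v).continuousOn.isOpen_inter_preimage hW isOpen_ne
  obtain ⟨R₁, hR₁, ε₁, hε₁, hball⟩ := exists_ball_smul_mem hW₁o (⟨hx, hv⟩ : x ∈ W₁) v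
  have hline : ∀ y ∈ Metric.ball x ε₁, ∀ t ∈ Metric.closedBall (0 : ℂ) R₁, ∀ {f : V → ℂ},
      DifferentiableOn ℂ f W →
      HasDerivAt (fun t : ℂ => f (y + t • v)) (fderiv ℂ f (y + t • v) v) t := by
    intro y hy t ht f hf
    have h1 := (hf.differentiableAt (hW.mem_nhds (hball y hy t ht).1)).hasFDerivAt
    have h2 : HasDerivAt (fun t : ℂ => y + t • v) v t := by
      simpa using ((hasDerivAt_id t).smul_const v).const_add y
    exact h1.comp_hasDerivAt t h2
  -- The derivative of s₂ along `v` is nonzero at x, so 0 is an isolated zero on the line through x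
  -- and small circles avoid zeros.
  obtain ⟨R, hR, hRR, hRne⟩ : ∃ R > 0, R < R₁ ∧ ∀ t ∈ Metric.sphere (0 : ℂ) R, s₂ (x + t • v) ≠ 0 := by
    have h0 := hline x (Metric.mem_ball_self hε₁) 0 (by simp [hR₁.le]) h2
    have hne := h0.eventually_ne (c := 0) (by simpa using hv)
    rw [eventually_nhdsWithin_iff, Metric.eventually_nhds_iff] at hne
    obtain ⟨ρ, hρ, hne⟩ := hne
    refine ⟨min ρ R₁ / 2, by positivity, by linarith [min_le_right ρ R₁], fun t ht => ?_⟩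
    have ht' : ‖t‖ = min ρ R₁ / 2 := by simpa using ht
    have hpos : 0 < min ρ R₁ := by positivity
    refine hne (by rw [dist_zero_right]; linarith [min_le_left ρ R₁]) ?_
    rintro rfl
    simp at ht'
    linarith
  set W₂ : Set V := {y | y ∈ W ∧ s₂ y ≠ 0} with hW₂
  have hW₂o : IsOpen W₂ := h2.continuousOn.isOpen_inter_preimage hW isOpen_ne
  have hq : DifferentiableOn ℂ (fun y => s₁ y / s₂ y) W₂ := fun y hy =>
    ((h1.differentiableAt (hW.mem_nhds hy.1)).div_complex (h2.differentiableAt (hW.mem_nhds hy.1))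
      hy.2).differentiableWithinAt
  have hsph : Metric.sphere (0 : ℂ) R ⊆ Metric.closedBall 0 R₁ :=
    Metric.sphere_subset_closedBall.trans (Metric.closedBall_subset_closedBall hRR.le)
  have hnear : ∀ᶠ y in 𝓝 x, ∀ t ∈ Metric.sphere (0 : ℂ) R, y + t • v ∈ W₂ := by
    refine (isCompact_sphere (0 : ℂ) R).eventually_forall_of_forall_eventually fun t ht => ?_
    have hc : ContinuousAt (fun z : V × ℂ => z.1 + z.2 • v) (x, t) := by fun_prop
    exact hc.eventually (hW₂o.mem_nhds ⟨(hball x (Metric.mem_ball_self hε₁) t (hsph ht)).1,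
      hRne t ht⟩)
  refine ⟨fun y => (2 * Real.pi * Complex.I : ℂ)⁻¹ *
    ∮ t in C(0, R), t⁻¹ * (s₁ (y + t • v) / s₂ (y + t • v)), ?_⟩
  filter_upwards [hnear, Metric.ball_mem_nhds x hε₁] with y hy hyε
  refine ⟨(differentiableAt_circleIntegral_translate hW₂o hq hR.le
    (ContinuousOn.inv₀ continuousOn_id fun t ht => ?_) hy).const_mul _, ?_⟩
  · have : ‖t‖ = R := by simpa using ht
    exact norm_pos_iff.1 (by rw [id, this]; exact hR)
  set A : ℂ → ℂ := fun t => s₁ (y + t • v)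
  set B : ℂ → ℂ := fun t => s₂ (y + t • v)
  have hbs : Metric.ball (0 : ℂ) R₁ ⊆ Metric.closedBall 0 R₁ := Metric.ball_subset_closedBall
  have hquot := differentiableOn_quotient_of_simple_zeros (U := Metric.ball 0 R₁)
    Metric.isOpen_ball (A := A) (B := B)
    (fun t ht => (hline y hyε t (hbs ht) h1).differentiableAt.differentiableWithinAt)
    (fun t ht => (hline y hyε t (hbs ht) h2).differentiableAt.differentiableWithinAt)
    (fun t ht hBt => ⟨h12 _ (hball y hyε t (hbs ht)).1 hBt, by
      rw [(hline y hyε t (hbs ht) h2).deriv]; exact (hball y hyε t (hbs ht)).2⟩)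
  have hcb : Metric.closedBall (0 : ℂ) R ⊆ Metric.ball 0 R₁ := Metric.closedBall_subset_ball hRR
  have hcl : DiffContOnCl ℂ (fun t => if B t = 0 then deriv A t / deriv B t else A t / B t)
      (Metric.ball 0 R) :=
    DifferentiableOn.diffContOnCl (by
      rw [closure_ball _ hR.ne']; exact hquot.mono hcb)
  have hCauchy := hcl.circleIntegral_sub_inv_smul (Metric.mem_ball_self hR)
  have hint : (∮ t in C(0, R), t⁻¹ * (A t / B t)) = ∮ t in C(0, R), (t - 0)⁻¹ •
      (if B t = 0 then deriv A t / deriv B t else A t / B t) := by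
    refine circleIntegral.integral_congr hR.le fun t ht => ?_
    have : B t ≠ 0 := (hy t ht).2
    simp [this]
  change s₁ y = s₂ y * ((2 * Real.pi * Complex.I : ℂ)⁻¹ * ∮ t in C(0, R), t⁻¹ * (A t / B t))
  rw [hint, hCauchy, smul_eq_mul, inv_mul_cancel_left₀ Complex.two_pi_I_ne_zero]
  have hA0 : A 0 = s₁ y := by simp [A]
  have hB0 : B 0 = s₂ y := by simp [B]
  have hyW : y ∈ W := by simpa using (hball y hyε 0 (by simp [hR₁.le])).1
  rw [hA0, hB0]
  split_ifs with h0
  · rw [h0, zero_mul, h12 y hyW h0]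
  · field_simp

/-- Local quotients glue because their values are forced: by division off Z, and by ds₁ = r ds₂ on
Z. The latter relation also shows that r does not vanish on Z. -/
theorem IsLocalEquation.exists_quotient {W Z : Set V} (hW : IsOpen W) {s₁ s₂ : V → ℂ}
    (h1 : IsLocalEquation W Z s₁) (h2 : IsLocalEquation W Z s₂) :
    ∃ r : V → ℂ, DifferentiableOn ℂ r W ∧ (∀ x ∈ W, r x ≠ 0) ∧ ∀ x ∈ W, s₁ x = s₂ x * r x := by
  have hex : ∀ x ∈ W, ∃ r : V → ℂ, ∀ᶠ y in 𝓝 x, DifferentiableAt ℂ r y ∧ s₁ y = s₂ y * r y :=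
    fun x hx => exists_local_quotient hW h1.holo h2.holo
      (fun y hy h => (h1.zero_iff y hy).2 ((h2.zero_iff y hy).1 h)) hx (h2.order_one x hx)
  choose! q hq using hex
  have hfd : ∀ y ∈ W, ∀ r : V → ℂ, (∀ᶠ p in 𝓝 y, DifferentiableAt ℂ r p ∧ s₁ p = s₂ p * r p) →
      s₂ y = 0 → fderiv ℂ s₁ y = r y • fderiv ℂ s₂ y := by
    intro y hy r hr h0
    have hd : DifferentiableAt ℂ s₂ y := h2.holo.differentiableAt (hW.mem_nhds hy)
    have he : s₁ =ᶠ[𝓝 y] fun p => s₂ p * r p := hr.mono fun p hp => hp.2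
    rw [he.fderiv_eq, fderiv_fun_mul hd hr.self_of_nhds.1, h0]
    ext w; simp
  have huniq : ∀ y ∈ W, ∀ r r' : V → ℂ,
      (∀ᶠ p in 𝓝 y, DifferentiableAt ℂ r p ∧ s₁ p = s₂ p * r p) →
      (∀ᶠ p in 𝓝 y, DifferentiableAt ℂ r' p ∧ s₁ p = s₂ p * r' p) → r y = r' y := by
    intro y hy r r' hr hr'
    by_cases h0 : s₂ y = 0
    · have e := (hfd y hy r hr h0).symm.trans (hfd y hy r' hr' h0)
      exact smul_left_injective ℂ (h2.order_one y hy h0) e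
    · exact mul_left_cancel₀ h0 (hr.self_of_nhds.2.symm.trans hr'.self_of_nhds.2)
  refine ⟨fun y => q y y, fun x hx => ?_, fun x hx (h0 : q x x = 0) => ?_, fun x hx => (hq x hx).self_of_nhds.2⟩
  · have hnear : ∀ᶠ y in 𝓝 x, q y y = q x y := by
      filter_upwards [(hq x hx).eventually_nhds, hW.mem_nhds hx] with y hy hyW
      exact huniq y hyW _ _ (hq y hyW) hy
    exact ((hq x hx).self_of_nhds.1.congr_of_eventuallyEq hnear).differentiableWithinAt
  · have hs1 : s₁ x = 0 := by rw [(hq x hx).self_of_nhds.2, h0, mul_zero]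
    have hs2 : s₂ x = 0 := (h2.zero_iff x hx).2 ((h1.zero_iff x hx).1 hs1)
    refine h1.order_one x hx hs1 ?_
    rw [hfd x hx _ (hq x hx) hs2, h0]
    ext w; simp

/-- On `A` the identity map coincides with y ↦ y - Re s(y) w. If ds(w) = 1, this map has at x a
derivative that kills w. Thus `A` is the image of `A` under a map with singular derivative, a null
set by the easy case of Sard's theorem. -/
theorem measure_zero_of_fderiv_ne_zero [MeasurableSpace V] [BorelSpace V] (μ : Measure V)
    [μ.IsAddHaarMeasure] {A : Set V} {s : V → ℂ} (h0 : ∀ x ∈ A, s x = 0)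
    (hs : ∀ x ∈ A, fderiv ℂ s x ≠ 0) : μ A = 0 := by
  have hex : ∀ x ∈ A, ∃ w, fderiv ℂ s x w = 1 := by
    intro x hx
    obtain ⟨v, hv⟩ : ∃ v, fderiv ℂ s x v ≠ 0 := by
      by_contra! hcon
      exact hs x hx (by ext v; simpa using hcon v)
    exact ⟨(fderiv ℂ s x v)⁻¹ • v, by simp [hv]⟩
  choose! w hw using hex
  have : FiniteDimensional ℝ V := FiniteDimensional.complexToReal V
  let L : V → V →L[ℝ] ℝ := fun x => Complex.reCLM.comp ((fderiv ℂ s x).restrictScalars ℝ)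
  have key := addHaar_image_eq_zero_of_det_fderivWithin_eq_zero (s := A) (f := id) μ
    (f' := fun x => ContinuousLinearMap.id ℝ V - (L x).smulRight (w x)) ?_ ?_
  · simpa using key
  · intro x hx
    have hd : DifferentiableAt ℂ s x := by
      by_contra hcon
      exact hs x hx (fderiv_zero_of_not_differentiableAt hcon)
    have h1 : HasFDerivAt (fun y => (s y).re) (L x) x :=
      Complex.reCLM.hasFDerivAt.comp x (hd.hasFDerivAt.restrictScalars ℝ)
    have h2 : HasFDerivWithinAt (fun y => y - (s y).re • w x)
        (ContinuousLinearMap.id ℝ V - (L x).smulRight (w x)) A x :=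
      ((hasFDerivAt_id x).sub (h1.smul_const (w x))).hasFDerivWithinAt
    exact h2.congr (fun y hy => by simp [h0 y hy]) (by simp [h0 x hx])
  · intro x hx
    have hwx := hw x hx
    rw [ContinuousLinearMap.det, LinearMap.det_eq_zero_iff_ker_ne_bot]
    refine (Submodule.ne_bot_iff _).2 ⟨w x, ?_, ?_⟩
    · simp [L, hwx]
    · intro h
      simp [h] at hwx

end SeveralVariables

/-! ### Calculus of i∂∂bar: linearity, holomorphic pullback, pluriharmonicity of log |r|. -/

section IddbarCalculus

variable {V V' : Type*} [NormedAddCommGroup V] [NormedSpace ℂ V]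
  [NormedAddCommGroup V'] [NormedSpace ℂ V']

theorem fderiv_fderiv_apply {u : V → ℝ} {x : V} (hu : ContDiffAt ℝ 2 u x) (a b : V) :
    fderiv ℝ (fun y => fderiv ℝ u y b) x a = fderiv ℝ (fderiv ℝ u) x a b := by
  have h : DifferentiableAt ℝ (fderiv ℝ u) x :=
    (hu.fderiv_right (m := 1) (by norm_num)).differentiableAt (by norm_num)
  rw [fderiv_clm_apply h (differentiableAt_const b)]
  simp

theorem fderiv_fderiv_symm {u : V → ℝ} {x : V} (hu : ContDiffAt ℝ 2 u x) (a b : V) :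
    fderiv ℝ (fderiv ℝ u) x a b = fderiv ℝ (fderiv ℝ u) x b a :=
  (hu.isSymmSndFDerivAt (by simp)) a b

theorem iddbar_eq {u : V → ℝ} {x : V} (hu : ContDiffAt ℝ 2 u x) (v w : V) :
    iddbar u x v w = (fderiv ℝ (fderiv ℝ u) x w (Complex.I • v) -
      fderiv ℝ (fderiv ℝ u) x v (Complex.I • w)) / 2 := by
  unfold iddbar conjDiff
  rw [fderiv_fun_neg, fderiv_fun_neg, neg_apply, neg_apply,
    fderiv_fderiv_apply hu, fderiv_fderiv_apply hu]
  ring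

theorem iddbar_congr {u u' : V → ℝ} {x : V} (h : u =ᶠ[𝓝 x] u') (v w : V) :
    iddbar u x v w = iddbar u' x v w := by
  unfold iddbar conjDiff
  have key : ∀ a b : V, fderiv ℝ (fun y => -(fderiv ℝ u y a)) x b =
      fderiv ℝ (fun y => -(fderiv ℝ u' y a)) x b := by
    intro a b
    rw [Filter.EventuallyEq.fderiv_eq]
    filter_upwards [h.eventuallyEq_nhds] with y hy
    rw [hy.fderiv_eq]
  rw [key, key]

theorem iddbar_const_mul_add {u u' : V → ℝ} {x : V} (hu : ContDiffAt ℝ 2 u x)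
    (hu' : ContDiffAt ℝ 2 u' x) (c : ℝ) (v w : V) :
    iddbar (fun y => c * u y + u' y) x v w = c * iddbar u x v w + iddbar u' x v w := by
  have hsum : ContDiffAt ℝ 2 (fun y => c * u y + u' y) x := (contDiffAt_const.mul hu).add hu'
  have h2 : fderiv ℝ (fun y => c * u y + u' y) =ᶠ[𝓝 x] fun y => c • fderiv ℝ u y + fderiv ℝ u' y := by
    filter_upwards [hu.eventually (by simp), hu'.eventually (by simp)] with y hy hy'
    have d1 := hy.differentiableAt (by norm_num)
    have d2 := hy'.differentiableAt (by norm_num)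
    rw [fderiv_fun_add (d1.const_mul c) d2, fderiv_const_mul d1]
  have e1 : DifferentiableAt ℝ (fderiv ℝ u) x :=
    (hu.fderiv_right (m := 1) (by norm_num)).differentiableAt (by norm_num)
  have e2 : DifferentiableAt ℝ (fderiv ℝ u') x :=
    (hu'.fderiv_right (m := 1) (by norm_num)).differentiableAt (by norm_num)
  rw [iddbar_eq hsum, iddbar_eq hu, iddbar_eq hu', h2.fderiv_eq,
    HasFDerivAt.fderiv (f := fun y => c • fderiv ℝ u y + fderiv ℝ u' y)
      ((e1.hasFDerivAt.const_smul c).add e2.hasFDerivAt)]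
  simp only [add_apply, smul_apply, smul_eq_mul]
  ring

theorem fderiv_real_apply_I_smul {F : V → V'} {x : V} (hF : DifferentiableAt ℂ F x) (v : V) :
    fderiv ℝ F x (Complex.I • v) = Complex.I • fderiv ℝ F x v := by
  rw [hF.fderiv_restrictScalars ℝ]
  simp

/-- The chain rule leaves an extra term du(D²F). It cancels after antisymmetrization, since D²F is
symmetric and complex linear for holomorphic F. -/
theorem iddbar_comp {u : V' → ℝ} {F : V → V'} {x : V} (hF : ContDiffAt ℝ 2 F x)
    (hF' : ∀ᶠ y in 𝓝 x, DifferentiableAt ℂ F y) (hu : ContDiffAt ℝ 2 u (F x)) (v w : V) :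
    iddbar (fun y => u (F y)) x v w = iddbar u (F x) (fderiv ℝ F x v) (fderiv ℝ F x w) := by
  have hcomp : ContDiffAt ℝ 2 (fun y => u (F y)) x := hu.comp x hF
  have hF1 : DifferentiableAt ℝ F x := hF.differentiableAt (by norm_num)
  have hdF : DifferentiableAt ℝ (fderiv ℝ F) x :=
    (hF.fderiv_right (m := 1) (by norm_num)).differentiableAt (by norm_num)
  have hdu : DifferentiableAt ℝ (fderiv ℝ u) (F x) :=
    (hu.fderiv_right (m := 1) (by norm_num)).differentiableAt (by norm_num)
  have hD2 : ∀ a b : V, fderiv ℝ (fderiv ℝ (fun y => u (F y))) x a b =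
      fderiv ℝ (fderiv ℝ u) (F x) (fderiv ℝ F x a) (fderiv ℝ F x b) +
        fderiv ℝ u (F x) (fderiv ℝ (fderiv ℝ F) x a b) := by
    intro a b
    rw [← fderiv_fderiv_apply hcomp]
    have he : (fun y => fderiv ℝ (fun y => u (F y)) y b) =ᶠ[𝓝 x]
        fun y => fderiv ℝ u (F y) (fderiv ℝ F y b) := by
      filter_upwards [hF.eventually (by simp), hF.continuousAt.eventually (hu.eventually (by simp))]
        with y hy hy'
      have := fderiv_comp y (hy'.differentiableAt (by norm_num)) (hy.differentiableAt (by norm_num))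
      change fderiv ℝ (u ∘ F) y b = _
      rw [this]; rfl
    rw [he.fderiv_eq]
    have h1 : HasFDerivAt (fun y => fderiv ℝ u (F y))
        ((fderiv ℝ (fderiv ℝ u) (F x)).comp (fderiv ℝ F x)) x :=
      hdu.hasFDerivAt.comp x hF1.hasFDerivAt
    have h2 : HasFDerivAt (fun y => fderiv ℝ F y b) ((fderiv ℝ (fderiv ℝ F) x).flip b) x := by
      simpa using hdF.hasFDerivAt.clm_apply (hasFDerivAt_const b x)
    rw [(h1.clm_apply h2).fderiv]
    simp [add_comm]
  have hI : ∀ a b : V, fderiv ℝ (fderiv ℝ F) x a (Complex.I • b) =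
      Complex.I • fderiv ℝ (fderiv ℝ F) x a b := by
    intro a b
    have h2 : ∀ b, HasFDerivAt (fun y => fderiv ℝ F y b) ((fderiv ℝ (fderiv ℝ F) x).flip b) x :=
      fun b => by simpa using hdF.hasFDerivAt.clm_apply (hasFDerivAt_const b x)
    have he : (fun y => fderiv ℝ F y (Complex.I • b)) =ᶠ[𝓝 x]
        fun y => Complex.I • fderiv ℝ F y b := by
      filter_upwards [hF'] with y hy
      exact fderiv_real_apply_I_smul hy b
    have h3 := (h2 (Complex.I • b)).unique
      (((h2 b).const_smul Complex.I).congr_of_eventuallyEq he)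
    simpa using congrArg (fun T => T a) h3
  have hsymm : fderiv ℝ (fderiv ℝ F) x v w = fderiv ℝ (fderiv ℝ F) x w v :=
    (hF.isSymmSndFDerivAt (by simp)) v w
  have hx := hF'.self_of_nhds
  rw [iddbar_eq hcomp, iddbar_eq hu, hD2, hD2, hI, hI, hsymm, fderiv_real_apply_I_smul hx,
    fderiv_real_apply_I_smul hx]
  ring

theorem contDiffAt_log_norm {r : V → ℂ} {x : V} {n : WithTop ℕ∞} (hr : ContDiffAt ℝ n r x)
    (h0 : r x ≠ 0) : ContDiffAt ℝ n (fun y => Real.log ‖r y‖) x :=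
  (hr.norm ℝ h0).log (by simpa using h0)

section FiniteDim

variable [FiniteDimensional ℂ V]

theorem DifferentiableOn.contDiffAt_real {W : Set V} (hW : IsOpen W) {f : V → ℂ}
    (hf : DifferentiableOn ℂ f W) {x : V} (hx : x ∈ W) {n : ℕ∞} : ContDiffAt ℝ n f x :=
  (((hf.contDiffOn_complex hW).contDiffAt (hW.mem_nhds hx)).restrict_scalars ℝ).of_le
    (mod_cast le_top)

/-- Locally log |r| is, up to a constant, the real part of a holomorphic logarithm. Dividing by the
value `r x` keeps the argument near 1, inside the slit plane. -/
theorem iddbar_log_norm {W : Set V} (hW : IsOpen W) {r : V → ℂ} (hr : DifferentiableOn ℂ r W)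
    {x : V} (hx : x ∈ W) (h0 : r x ≠ 0) (v w : V) :
    iddbar (fun y => Real.log ‖r y‖) x v w = 0 := by
  have hc : ContinuousAt r x := (hr.differentiableAt (hW.mem_nhds hx)).continuousAt
  have hslit : ∀ᶠ y in 𝓝 x, r y / r x ∈ Complex.slitPlane := by
    have : ContinuousAt (fun y => r y / r x) x := hc.div_const _
    refine this.eventually (Complex.isOpen_slitPlane.mem_nhds ?_)
    simp only [div_self h0]; exact Complex.one_mem_slitPlane
  set W' : Set V := {y | y ∈ W ∧ r y / r x ∈ Complex.slitPlane}
  have hW' : IsOpen W' :=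
    (hr.continuousOn.div_const (r x)).isOpen_inter_preimage hW Complex.isOpen_slitPlane
  have hxW' : x ∈ W' := ⟨hx, hslit.self_of_nhds⟩
  have hL : DifferentiableOn ℂ (fun y => Complex.log (r y / r x)) W' := fun y hy =>
    (DifferentiableAt.clog ((hr.differentiableAt (hW.mem_nhds hy.1)).mul_const _)
      hy.2).differentiableWithinAt
  have he : (fun y => Real.log ‖r y‖) =ᶠ[𝓝 x]
      fun y => (fun z : ℂ => z.re + Real.log ‖r x‖) (Complex.log (r y / r x)) := by
    filter_upwards [hc.eventually_ne h0] with y hy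
    simp only [Complex.log_re, norm_div]
    rw [Real.log_div (by simpa using hy) (by simpa using h0)]
    ring
  rw [iddbar_congr he, iddbar_comp (u := fun z : ℂ => z.re + Real.log ‖r x‖)
    (hL.contDiffAt_real hW' hxW' (n := 2))]
  · have hre : ∀ y : ℂ, fderiv ℝ (fun z : ℂ => z.re + Real.log ‖r x‖) y = Complex.reCLM := by
      intro y
      rw [fderiv_add_const]
      exact Complex.reCLM.fderiv
    unfold iddbar conjDiff
    simp [hre]
  · filter_upwards [hW'.mem_nhds hxW'] with y hy using hL.differentiableAt (hW'.mem_nhds hy)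
  · exact (Complex.reCLM.contDiff.add contDiff_const).contDiffAt

end FiniteDim

end IddbarCalculus

/-! ### Integration by parts: the current dd^c u of a C² function is given by a form. -/

section IntegrationByParts

theorem continuous_mul_of_tsupport_subset {X : Type*} [TopologicalSpace X] {W : Set X}
    (hW : IsOpen W) {p h : X → ℝ} (hp : ContinuousOn p W) (hh : Continuous h) (hs : tsupport h ⊆ W) :
    Continuous fun x => p x * h x := by
  rw [continuous_iff_continuousAt]
  intro x
  by_cases hx : x ∈ tsupport h
  · exact (hp.continuousAt (hW.mem_nhds (hs hx))).mul hh.continuousAt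
  · have : (fun x => p x * h x) =ᶠ[𝓝 x] fun _ => 0 := by
      filter_upwards [notMem_tsupport_iff_eventuallyEq.1 hx] with y hy
      simp [hy]
    exact continuousAt_const.congr this.symm

theorem setIntegral_mul_eq_integral {X : Type*} [TopologicalSpace X] [MeasureSpace X]
    {W : Set X} {p h : X → ℝ}
    (hs : tsupport h ⊆ W) :
    ∫ x in W, p x * h x = ∫ x, p x * h x :=
  setIntegral_eq_integral_of_forall_compl_eq_zero fun x hx => by
    rw [image_eq_zero_of_notMem_tsupport fun h' => hx (hs h'), mul_zero]

variable {V : Type*} [NormedAddCommGroup V] [NormedSpace ℂ V]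

variable [FiniteDimensional ℂ V] [MeasureSpace V] [BorelSpace V]
  [(volume : Measure V).IsAddHaarMeasure]

theorem integrable_mul_of_tsupport_subset {W : Set V} (hW : IsOpen W) {p h : V → ℝ}
    (hp : ContinuousOn p W) (hh : Continuous h) (hs : tsupport h ⊆ W) (hc : HasCompactSupport h) :
    Integrable fun x => p x * h x := by
  have : FiniteDimensional ℝ V := FiniteDimensional.complexToReal V
  exact (continuous_mul_of_tsupport_subset hW hp hh hs).integrable_of_hasCompactSupport hc.mul_left

theorem setIntegral_mul_fderiv_eq_neg {W : Set V} (hW : IsOpen W) {u h : V → ℝ}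
    (hu : ContDiffOn ℝ 1 u W) (hh : ContDiff ℝ 1 h) (hs : tsupport h ⊆ W)
    (hc : HasCompactSupport h) (a : V) :
    ∫ x in W, u x * fderiv ℝ h x a = -∫ x in W, fderiv ℝ u x a * h x := by
  have : FiniteDimensional ℝ V := FiniteDimensional.complexToReal V
  have hs' : tsupport (fun x => fderiv ℝ h x a) ⊆ tsupport h := tsupport_fderiv_apply_subset ℝ a
  have hu' : ContinuousOn (fun x => fderiv ℝ u x a) W :=
    (hu.continuousOn_fderiv_of_isOpen hW le_rfl).clm_apply continuousOn_const
  have hh' : Continuous fun x => fderiv ℝ h x a :=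
    (hh.continuous_fderiv one_ne_zero).clm_apply continuous_const
  rw [setIntegral_mul_eq_integral hs, setIntegral_mul_eq_integral (hs'.trans hs)]
  refine integral_mul_fderiv_eq_neg_fderiv_mul_of_integrable
    (integrable_mul_of_tsupport_subset hW hu' hh.continuous hs hc)
    (integrable_mul_of_tsupport_subset hW hu.continuousOn hh' (hs'.trans hs)
      (hc.fderiv_apply (𝕜 := ℝ) a))
    (integrable_mul_of_tsupport_subset hW hu.continuousOn hh.continuous hs hc)
    (fun x hx => (hu.differentiableOn one_ne_zero).differentiableAt (hW.mem_nhds (hs hx)))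
    (fun x _ => hh.differentiable one_ne_zero x)

/-- Two integrations by parts, whose signs cancel; they interchange the directions `a` and `b`,
which the symmetry of the second derivative undoes. -/
theorem setIntegral_mul_fderiv_fderiv {W : Set V} (hW : IsOpen W) {u h : V → ℝ}
    (hu : ContDiffOn ℝ 2 u W) (hh : ContDiff ℝ 2 h) (hs : tsupport h ⊆ W)
    (hc : HasCompactSupport h) (a b : V) :
    ∫ x in W, u x * fderiv ℝ (fderiv ℝ h) x a b =
      ∫ x in W, fderiv ℝ (fderiv ℝ u) x a b * h x := by
  have hs' : tsupport (fun x => fderiv ℝ h x b) ⊆ tsupport h := tsupport_fderiv_apply_subset ℝ b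
  have hh1 : ContDiff ℝ 1 fun x => fderiv ℝ h x b :=
    (hh.fderiv_right (m := 1) (by norm_num)).clm_apply contDiff_const
  have hu1 : ContDiffOn ℝ 1 (fun x => fderiv ℝ u x a) W :=
    (hu.fderiv_of_isOpen hW (m := 1) (by norm_num)).clm_apply contDiffOn_const
  calc ∫ x in W, u x * fderiv ℝ (fderiv ℝ h) x a b
      = ∫ x in W, u x * fderiv ℝ (fun y => fderiv ℝ h y b) x a := by
        simp_rw [fderiv_fderiv_apply hh.contDiffAt]
    _ = -∫ x in W, fderiv ℝ u x a * fderiv ℝ h x b :=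
        setIntegral_mul_fderiv_eq_neg hW (hu.of_le (by norm_num)) hh1 (hs'.trans hs)
          (hc.fderiv_apply (𝕜 := ℝ) b) a
    _ = ∫ x in W, fderiv ℝ (fun y => fderiv ℝ u y a) x b * h x := by
        rw [setIntegral_mul_fderiv_eq_neg hW hu1 (hh.of_le (by norm_num)) hs hc b, neg_neg]
    _ = ∫ x in W, fderiv ℝ (fderiv ℝ u) x a b * h x := by
        refine setIntegral_congr_fun hW.measurableSet fun x hx => ?_
        have hux := hu.contDiffAt (hW.mem_nhds hx)
        simp only [fderiv_fderiv_apply hux, fderiv_fderiv_symm hux b a]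

theorem ddcCurrent_eq_setIntegral {W : Set V} (hW : IsOpen W) {u g : V → ℝ}
    (hu : ContDiffOn ℝ 2 u W) (hg : IsTestFunction W g) (v w : V) :
    ddcCurrent W u v w g = ∫ x in W, iddbar u x v w / Real.pi * g x := by
  obtain ⟨hg1, hgc, hgs⟩ := hg
  have hg2 : ContDiff ℝ 2 g := hg1.of_le (show ((2 : ℕ∞) : WithTop ℕ∞) ≤ ∞ from mod_cast le_top)
  have hDg : ∀ a b : V, Integrable fun x => u x * fderiv ℝ (fderiv ℝ g) x a b := by
    intro a b
    simp_rw [← fderiv_fderiv_apply hg2.contDiffAt]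
    have hs1 : tsupport (fun x => fderiv ℝ g x b) ⊆ tsupport g := tsupport_fderiv_apply_subset ℝ b
    have hs2 := tsupport_fderiv_apply_subset (f := fun x => fderiv ℝ g x b) ℝ a
    have hc1 : HasCompactSupport fun x => fderiv ℝ g x b := hgc.fderiv_apply (𝕜 := ℝ) b
    refine integrable_mul_of_tsupport_subset hW hu.continuousOn ?_ (hs2.trans (hs1.trans hgs))
      (hc1.fderiv_apply (𝕜 := ℝ) a)
    have hh1 : ContDiff ℝ 1 fun x => fderiv ℝ g x b :=
      (hg2.fderiv_right (m := 1) (by norm_num)).clm_apply contDiff_const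
    exact (hh1.continuous_fderiv one_ne_zero).clm_apply continuous_const
  have hDu : ∀ a b : V, Integrable (fun x => fderiv ℝ (fderiv ℝ u) x a b * g x) := by
    intro a b
    refine integrable_mul_of_tsupport_subset hW ?_ hg2.continuous hgs hgc
    exact (((hu.fderiv_of_isOpen hW (m := 1) (by norm_num)).continuousOn_fderiv_of_isOpen hW
      le_rfl).clm_apply continuousOn_const).clm_apply continuousOn_const
  calc ddcCurrent W u v w g
      = ∫ x in W, (u x * fderiv ℝ (fderiv ℝ g) x w (Complex.I • v) -
          u x * fderiv ℝ (fderiv ℝ g) x v (Complex.I • w)) * (1 / (2 * Real.pi)) := by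
        unfold ddcCurrent ddc
        congr 1; ext x
        rw [iddbar_eq hg2.contDiffAt]
        field_simp
    _ = ∫ x in W, (fderiv ℝ (fderiv ℝ u) x w (Complex.I • v) * g x -
          fderiv ℝ (fderiv ℝ u) x v (Complex.I • w) * g x) * (1 / (2 * Real.pi)) := by
        rw [integral_mul_const, integral_mul_const,
          integral_sub (hDg _ _).integrableOn (hDg _ _).integrableOn,
          integral_sub (hDu _ _).integrableOn (hDu _ _).integrableOn,
          setIntegral_mul_fderiv_fderiv hW hu hg2 hgs hgc,
          setIntegral_mul_fderiv_fderiv hW hu hg2 hgs hgc]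
    _ = ∫ x in W, iddbar u x v w / Real.pi * g x := by
        refine setIntegral_congr_fun hW.measurableSet fun x hx => ?_
        simp only [iddbar_eq (hu.contDiffAt (hW.mem_nhds hx))]
        field_simp

end IntegrationByParts

/-! ### The form μ in Betti coordinates. -/

section BettiForm

theorem fderiv_apply_eq_of_hasDerivAt {V : Type*} [NormedAddCommGroup V] [NormedSpace ℝ V]
    {u : V → ℝ} {x v : V} {d : ℝ} (hu : DifferentiableAt ℝ u x)
    (h : HasDerivAt (fun s : ℝ => u (x + s • v)) d 0) : fderiv ℝ u x v = d := by
  rw [← hu.lineDeriv_eq_fderiv]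
  exact HasLineDerivAt.lineDeriv h

theorem hasDerivAt_im_line (a b : ℂ) : HasDerivAt (fun s : ℝ => (a + s • b).im) b.im 0 := by
  simpa using ((hasDerivAt_id (0 : ℝ)).mul_const b.im).const_add a.im

theorem hasDerivAt_re_line (a b : ℂ) : HasDerivAt (fun s : ℝ => (a + s • b).re) b.re 0 := by
  simpa using ((hasDerivAt_id (0 : ℝ)).mul_const b.re).const_add a.re

theorem contDiff_im_fst : ContDiff ℝ ∞ fun q : ℂ × ℂ => q.1.im :=
  Complex.imCLM.contDiff.comp contDiff_fst

theorem contDiff_im_snd : ContDiff ℝ ∞ fun q : ℂ × ℂ => q.2.im :=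
  Complex.imCLM.contDiff.comp contDiff_snd

theorem contDiff_re_fst : ContDiff ℝ ∞ fun q : ℂ × ℂ => q.1.re :=
  Complex.reCLM.contDiff.comp contDiff_fst

theorem contDiff_re_snd : ContDiff ℝ ∞ fun q : ℂ × ℂ => q.2.re :=
  Complex.reCLM.contDiff.comp contDiff_snd

theorem contDiffAt_im_sq_div_im {p : ℂ × ℂ} (hp : 0 < p.1.im) :
    ContDiffAt ℝ ∞ (fun q : ℂ × ℂ => q.2.im ^ 2 / q.1.im) p :=
  (contDiff_im_snd.pow 2).contDiffAt.div contDiff_im_fst.contDiffAt hp.ne'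

theorem contDiffAt_betti₂ {p : ℂ × ℂ} (hp : 0 < p.1.im) : ContDiffAt ℝ ∞ betti₂ p :=
  contDiff_im_snd.contDiffAt.div contDiff_im_fst.contDiffAt hp.ne'

theorem contDiffAt_betti₁ {p : ℂ × ℂ} (hp : 0 < p.1.im) : ContDiffAt ℝ ∞ betti₁ p :=
  contDiff_re_snd.contDiffAt.sub ((contDiffAt_betti₂ hp).mul contDiff_re_fst.contDiffAt)

theorem fderiv_betti₂ {p : ℂ × ℂ} (hp : 0 < p.1.im) (v : ℂ × ℂ) :
    fderiv ℝ betti₂ p v = (v.2.im - betti₂ p * v.1.im) / p.1.im := by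
  refine fderiv_apply_eq_of_hasDerivAt ((contDiffAt_betti₂ hp).differentiableAt (by simp)) ?_
  have h := (hasDerivAt_im_line p.2 v.2).div (hasDerivAt_im_line p.1 v.1) (by simpa using hp.ne')
  refine HasDerivAt.congr_deriv h ?_
  simp [betti₂]
  field_simp

theorem fderiv_betti₁ {p : ℂ × ℂ} (hp : 0 < p.1.im) (v : ℂ × ℂ) :
    fderiv ℝ betti₁ p v = v.2.re - fderiv ℝ betti₂ p v * p.1.re - betti₂ p * v.1.re := by
  rw [fderiv_betti₂ hp]
  refine fderiv_apply_eq_of_hasDerivAt ((contDiffAt_betti₁ hp).differentiableAt (by simp)) ?_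
  have h := (hasDerivAt_re_line p.2 v.2).sub (((hasDerivAt_im_line p.2 v.2).div
    (hasDerivAt_im_line p.1 v.1) (by simpa using hp.ne')).mul (hasDerivAt_re_line p.1 v.1))
  refine HasDerivAt.congr_deriv h ?_
  simp [betti₂]
  field_simp
  ring

theorem conjDiff_im_sq_div_im {p : ℂ × ℂ} (hp : 0 < p.1.im) (w : ℂ × ℂ) :
    conjDiff (fun q : ℂ × ℂ => q.2.im ^ 2 / q.1.im) p w =
      -(2 * p.2.im * w.2.re / p.1.im - p.2.im ^ 2 * w.1.re / p.1.im ^ 2) := by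
  unfold conjDiff
  congr 1
  refine fderiv_apply_eq_of_hasDerivAt ((contDiffAt_im_sq_div_im hp).differentiableAt (by simp)) ?_
  have h := ((hasDerivAt_im_line p.2 (Complex.I * w.2)).pow 2).div
    (hasDerivAt_im_line p.1 (Complex.I * w.1)) (by simpa using hp.ne')
  refine HasDerivAt.congr_deriv h ?_
  simp
  field_simp

theorem isOpen_im_fst_pos : IsOpen {p : ℂ × ℂ | 0 < p.1.im} :=
  isOpen_lt continuous_const (by fun_prop)

theorem fderiv_conjDiff_im_sq_div_im {p : ℂ × ℂ} (hp : 0 < p.1.im) (v w : ℂ × ℂ) :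
    fderiv ℝ (fun y => conjDiff (fun q : ℂ × ℂ => q.2.im ^ 2 / q.1.im) y w) p v =
      -(2 * v.2.im * w.2.re / p.1.im - 2 * p.2.im * w.2.re * v.1.im / p.1.im ^ 2
        - (2 * p.2.im * v.2.im * w.1.re / p.1.im ^ 2
          - 2 * p.2.im ^ 2 * w.1.re * v.1.im / p.1.im ^ 3)) := by
  have he : (fun y => conjDiff (fun q : ℂ × ℂ => q.2.im ^ 2 / q.1.im) y w) =ᶠ[𝓝 p]
      fun y : ℂ × ℂ => -(2 * y.2.im * w.2.re / y.1.im - y.2.im ^ 2 * w.1.re / y.1.im ^ 2) := by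
    filter_upwards [isOpen_im_fst_pos.mem_nhds hp] with y hy
    exact conjDiff_im_sq_div_im hy w
  have hd : ContDiffAt ℝ ∞
      (fun y : ℂ × ℂ => -(2 * y.2.im * w.2.re / y.1.im - y.2.im ^ 2 * w.1.re / y.1.im ^ 2)) p := by
    have h1 := contDiff_im_fst.contDiffAt (x := p)
    have h2 := contDiff_im_snd.contDiffAt (x := p)
    exact ((((contDiffAt_const.mul h2).mul contDiffAt_const).div h1 hp.ne').sub
      (((h2.pow 2).mul contDiffAt_const).div (h1.pow 2) (pow_ne_zero 2 hp.ne'))).neg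
  rw [he.fderiv_eq]
  refine fderiv_apply_eq_of_hasDerivAt (hd.differentiableAt (by simp)) ?_
  have h2 := hasDerivAt_im_line p.2 v.2
  have h1 := hasDerivAt_im_line p.1 v.1
  have h := ((((h2.const_mul 2).mul_const w.2.re).div h1 (by simpa using hp.ne')).sub
    (((h2.pow 2).mul_const w.1.re).div (h1.pow 2) (by simpa using hp.ne'))).neg
  refine HasDerivAt.congr_deriv h ?_
  simp
  field_simp

theorem muForm_eq_wedgeDiff {p : ℂ × ℂ} (hp : 0 < p.1.im) (v w : ℂ × ℂ) :
    muForm p v w = wedgeDiff betti₁ betti₂ p v w := by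
  unfold muForm iddbar wedgeDiff
  rw [fderiv_conjDiff_im_sq_div_im hp, fderiv_conjDiff_im_sq_div_im hp, fderiv_betti₁ hp,
    fderiv_betti₁ hp, fderiv_betti₂ hp, fderiv_betti₂ hp]
  unfold betti₂
  field_simp
  ring

end BettiForm

/-! ### The current of a potential with logarithmic singularities. -/

section PotentialCurrent

variable {V : Type*} [NormedAddCommGroup V] [NormedSpace ℂ V] [FiniteDimensional ℂ V]

theorem contDiffAt_im_sq_div_im_comp {W : Set V} (hW : IsOpen W) {A : V → ℂ × ℂ}
    (hA : DifferentiableOn ℂ A W) (hpos : ∀ x ∈ W, 0 < (A x).1.im) {x : V} (hx : x ∈ W) :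
    ContDiffAt ℝ 2 A x ∧ ContDiffAt ℝ 2 (fun y => (A y).2.im ^ 2 / (A y).1.im) x := by
  have h1 : ContDiffAt ℝ 2 A x :=
    (hA.fst.contDiffAt_real hW hx (n := 2)).prodMk (hA.snd.contDiffAt_real hW hx (n := 2))
  exact ⟨h1, ((contDiffAt_im_sq_div_im (hpos x hx)).of_le
    (show ((2 : ℕ∞) : WithTop ℕ∞) ≤ ∞ from mod_cast le_top)).comp x h1⟩

theorem iddbar_im_sq_div_im_comp {W : Set V} (hW : IsOpen W) {A : V → ℂ × ℂ}
    (hA : DifferentiableOn ℂ A W) (hpos : ∀ x ∈ W, 0 < (A x).1.im) {x : V} (hx : x ∈ W) (v w : V) :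
    iddbar (fun y => (A y).2.im ^ 2 / (A y).1.im) x v w =
      muForm (A x) (fderiv ℝ A x v) (fderiv ℝ A x w) :=
  iddbar_comp (u := fun q : ℂ × ℂ => q.2.im ^ 2 / q.1.im)
    (contDiffAt_im_sq_div_im_comp hW hA hpos hx).1
    (by filter_upwards [hW.mem_nhds hx] with y hy using hA.differentiableAt (hW.mem_nhds hy))
    ((contDiffAt_im_sq_div_im (hpos x hx)).of_le
      (show ((2 : ℕ∞) : WithTop ℕ∞) ≤ ∞ from mod_cast le_top)) v w

variable [MeasureSpace V] [BorelSpace V] [(volume : Measure V).IsAddHaarMeasure]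

/-- Here s' plays the role of Θ composed with A. Off the null set Z, `p` equals the C² function π
(Im z)² / Im τ + log |s/s'|, and the logarithm contributes nothing to dd^c. The formula for `p` is
only required off Z, since values of the height on the zero section carry no meaning. The space V is
general so that both charts of the surface and single fibres are covered. -/
theorem potential_current {W Z : Set V} (hW : IsOpen W) {A : V → ℂ × ℂ}
    (hA : DifferentiableOn ℂ A W) (hpos : ∀ x ∈ W, 0 < (A x).1.im) {s s' : V → ℂ}
    (hs : IsLocalEquation W Z s) (hs' : IsLocalEquation W Z s') {p : V → ℝ}
    (hp : ∀ x ∈ W, x ∉ Z → p x = Real.pi * ((A x).2.im ^ 2 / (A x).1.im) - Real.log ‖s' x‖ +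
      Real.log ‖s x‖) :
    LocallyIntegrableOn p W ∧ ∀ (v w : V) (g : V → ℝ), IsTestFunction W g →
      ddcCurrent W p v w g =
        ∫ x in W, muForm (A x) (fderiv ℝ A x v) (fderiv ℝ A x w) * g x := by
  obtain ⟨r, hr, hr0, hsr⟩ := hs.exists_quotient hW hs'
  set u : V → ℝ := fun x => Real.pi * ((A x).2.im ^ 2 / (A x).1.im) + Real.log ‖r x‖ with hu
  have hnull : volume {x | x ∈ W ∧ s' x = 0} = 0 :=
    measure_zero_of_fderiv_ne_zero volume (fun x hx => hx.2) fun x hx => hs'.order_one x hx.1 hx.2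
  have hpu : ∀ᵐ x, x ∈ W → p x = u x := by
    have : ∀ᵐ x, x ∉ {x | x ∈ W ∧ s' x = 0} := measure_eq_zero_iff_ae_notMem.1 hnull
    filter_upwards [this] with x hx hxW
    have h0 : s' x ≠ 0 := fun h => hx ⟨hxW, h⟩
    rw [hp x hxW fun hZ => h0 ((hs'.zero_iff x hxW).2 hZ), hsr x hxW, norm_mul,
      Real.log_mul (norm_ne_zero_iff.2 h0) (norm_ne_zero_iff.2 (hr0 x hxW))]
    simp only [hu]; ring
  have hpu' : p =ᵐ[volume.restrict W] u := (ae_restrict_iff' hW.measurableSet).2 hpu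
  have hlog : ∀ x ∈ W, ContDiffAt ℝ 2 (fun y => Real.log ‖r y‖) x := fun x hx =>
    contDiffAt_log_norm (hr.contDiffAt_real hW hx (n := 2)) (hr0 x hx)
  have huC : ∀ x ∈ W, ContDiffAt ℝ 2 u x := fun x hx =>
    (contDiffAt_const.mul (contDiffAt_im_sq_div_im_comp hW hA hpos hx).2).add (hlog x hx)
  have huW : ContDiffOn ℝ 2 u W := fun x hx => (huC x hx).contDiffWithinAt
  refine ⟨?_, fun v w g hg => ?_⟩
  · have hul : LocallyIntegrableOn u W := huW.continuousOn.locallyIntegrableOn hW.measurableSet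
    intro x hx
    obtain ⟨N, hN, hNi⟩ := hul x hx
    refine ⟨N ∩ W, Filter.inter_mem hN self_mem_nhdsWithin, ?_⟩
    have hpN : p =ᵐ[volume.restrict (N ∩ W)] u :=
      ae_restrict_of_ae_restrict_of_subset inter_subset_right hpu'
    exact (hNi.mono_set inter_subset_left).congr_fun_ae hpN.symm
  · have h1 : ddcCurrent W p v w g = ddcCurrent W u v w g := by
      refine integral_congr_ae ?_
      filter_upwards [hpu'] with x hx
      rw [hx]
    rw [h1, ddcCurrent_eq_setIntegral hW huW hg]
    refine setIntegral_congr_fun hW.measurableSet fun x hx => ?_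
    simp only [hu]
    rw [iddbar_const_mul_add (contDiffAt_im_sq_div_im_comp hW hA hpos hx).2 (hlog x hx),
      iddbar_log_norm hW hr hx (hr0 x hx), iddbar_im_sq_div_im_comp hW hA hpos hx]
    field_simp
    ring

end PotentialCurrent

/-! ### The q-Pochhammer product. -/

section QPochhammer

/-- The infinite `q`-Pochhammer symbol `∏ (1 - q ^ n w)`. -/
def qPochhammer (q w : ℂ) : ℂ := ∏' n : ℕ, (1 + -(q ^ n * w))

theorem summable_norm_qPochhammer {q : ℂ} (hq : ‖q‖ < 1) (w : ℂ) :
    Summable fun n : ℕ => ‖-(q ^ n * w)‖ := by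
  simp only [norm_neg, norm_mul, norm_pow]
  exact (summable_geometric_of_lt_one (norm_nonneg q) hq).mul_right _

theorem multipliable_qPochhammer {q : ℂ} (hq : ‖q‖ < 1) (w : ℂ) :
    Multipliable fun n : ℕ => 1 + -(q ^ n * w) :=
  multipliable_one_add_of_summable (summable_norm_qPochhammer hq w)

theorem qPochhammer_eq_mul {q : ℂ} (hq : ‖q‖ < 1) (w : ℂ) :
    qPochhammer q w = (1 - w) * qPochhammer q (q * w) := by
  have h := multipliable_qPochhammer hq (q * w)
  unfold qPochhammer
  rw [tprod_eq_zero_mul']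
  · simp only [pow_zero, one_mul, ← sub_eq_add_neg, pow_succ, mul_assoc]
  · simpa only [pow_succ, mul_assoc] using h

theorem qPochhammer_eq_zero_iff {q : ℂ} (hq : ‖q‖ < 1) (w : ℂ) :
    qPochhammer q w = 0 ↔ ∃ n : ℕ, q ^ n * w = 1 := by
  constructor
  · intro h
    by_contra! hcon
    refine tprod_one_add_ne_zero_of_summable (fun n => ?_) (summable_norm_qPochhammer hq w) h
    rw [← sub_eq_add_neg]
    exact sub_ne_zero.2 (hcon n).symm
  · rintro ⟨n, hn⟩
    exact tprod_of_exists_eq_zero ⟨n, by rw [hn]; ring⟩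

/-- On bounded w and ‖q‖ < r < 1 the factors are controlled by a geometric series, so the product
converges locally uniformly in both variables jointly. -/
theorem differentiableOn_qPochhammer :
    DifferentiableOn ℂ (fun p : ℂ × ℂ => qPochhammer p.1 p.2) {p | ‖p.1‖ < 1} := by
  intro p hp
  obtain ⟨r, hpr, hr⟩ := exists_between (show ‖p.1‖ < 1 from hp)
  have hr0 : 0 ≤ r := (norm_nonneg _).trans hpr.le
  set K : Set (ℂ × ℂ) := {x | ‖x.1‖ < r ∧ ‖x.2‖ < ‖p.2‖ + 1} with hK
  have hKo : IsOpen K := by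
    have h1 : IsOpen {x : ℂ × ℂ | ‖x.1‖ < r} := isOpen_lt (by fun_prop) continuous_const
    have h2 : IsOpen {x : ℂ × ℂ | ‖x.2‖ < ‖p.2‖ + 1} := isOpen_lt (by fun_prop) continuous_const
    exact h1.inter h2
  have hlim := Summable.hasProdLocallyUniformlyOn_nat_one_add
    (f := fun (n : ℕ) (x : ℂ × ℂ) => -(x.1 ^ n * x.2)) hKo
    ((summable_geometric_of_lt_one hr0 hr).mul_right (‖p.2‖ + 1))
    (Filter.Eventually.of_forall fun n x hx => by
      rw [norm_neg, norm_mul, norm_pow]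
      have := hx.1.le
      have := hx.2.le
      gcongr)
    (fun n => by fun_prop)
  have hd : DifferentiableOn ℂ (fun p : ℂ × ℂ => qPochhammer p.1 p.2) K :=
    TendstoLocallyUniformlyOn.differentiableOn_complex hKo
      (hasProdLocallyUniformlyOn_iff_tendstoLocallyUniformlyOn.1 hlim) fun s =>
        (ContDiff.differentiable (n := 1) (contDiff_prod fun i _ => by fun_prop)
          one_ne_zero).differentiableOn
  exact (hd.differentiableAt (hKo.mem_nhds ⟨hpr, by simp⟩)).differentiableWithinAt

end QPochhammer

/-! ### The odd theta function: quasi-periodicity and simple zeros at the lattice. -/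

section Theta

open Complex (exp)

/-- `e x = exp (2 π i x)`. -/
def expTwoPiI (x : ℂ) : ℂ := exp (2 * Real.pi * Complex.I * x)

theorem expTwoPiI_add (x y : ℂ) : expTwoPiI (x + y) = expTwoPiI x * expTwoPiI y := by
  simp only [expTwoPiI, mul_add, Complex.exp_add]

theorem expTwoPiI_ne_zero (x : ℂ) : expTwoPiI x ≠ 0 := Complex.exp_ne_zero _

theorem expTwoPiI_neg (x : ℂ) : expTwoPiI (-x) = (expTwoPiI x)⁻¹ := by
  simp only [expTwoPiI, mul_neg, Complex.exp_neg]

theorem expTwoPiI_zero : expTwoPiI 0 = 1 := by simp [expTwoPiI]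

theorem expTwoPiI_one : expTwoPiI 1 = 1 := by
  simp [expTwoPiI, Complex.exp_two_pi_mul_I]

theorem expTwoPiI_natMul (n : ℕ) (x : ℂ) : expTwoPiI x ^ n = expTwoPiI (n * x) := by
  simp only [expTwoPiI, ← Complex.exp_nat_mul]
  ring_nf

theorem expTwoPiI_eq_one_iff (x : ℂ) : expTwoPiI x = 1 ↔ ∃ m : ℤ, x = m := by
  unfold expTwoPiI
  rw [Complex.exp_eq_one_iff]
  refine exists_congr fun m => ?_
  rw [mul_comm (m : ℂ)]
  exact mul_right_inj' Complex.two_pi_I_ne_zero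

theorem norm_expTwoPiI (x : ℂ) : ‖expTwoPiI x‖ = Real.exp (-(2 * Real.pi * x.im)) := by
  simp [expTwoPiI, Complex.norm_exp]

theorem norm_expTwoPiI_lt_one {τ : ℂ} (hτ : 0 < τ.im) : ‖expTwoPiI τ‖ < 1 := by
  rw [norm_expTwoPiI, Real.exp_lt_one_iff]
  have := Real.pi_pos
  nlinarith [mul_pos this hτ]

theorem differentiable_expTwoPiI : Differentiable ℂ expTwoPiI := by
  unfold expTwoPiI
  fun_prop

theorem hasDerivAt_expTwoPiI (x : ℂ) :
    HasDerivAt expTwoPiI (2 * Real.pi * Complex.I * expTwoPiI x) x := by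
  refine ((hasDerivAt_id x).const_mul (2 * Real.pi * Complex.I : ℂ)).cexp.congr_deriv ?_
  simp only [expTwoPiI, id]
  ring

/-- The odd theta function of `ℂ / (ℤ + ℤ τ)`, up to a factor depending on `τ`. -/
def oddTheta (τ z : ℂ) : ℂ :=
  expTwoPiI (-z / 2) * (qPochhammer (expTwoPiI τ) (expTwoPiI z) *
    qPochhammer (expTwoPiI τ) (expTwoPiI (τ - z)))

theorem differentiableOn_oddTheta :
    DifferentiableOn ℂ (fun p : ℂ × ℂ => oddTheta p.1 p.2) {p | 0 < p.1.im} := by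
  have he := differentiable_expTwoPiI
  unfold oddTheta
  refine DifferentiableOn.mul (by fun_prop) (DifferentiableOn.mul ?_ ?_)
  · exact differentiableOn_qPochhammer.comp
      (f := fun p : ℂ × ℂ => (expTwoPiI p.1, expTwoPiI p.2)) (by fun_prop)
      fun p hp => norm_expTwoPiI_lt_one hp
  · exact differentiableOn_qPochhammer.comp
      (f := fun p : ℂ × ℂ => (expTwoPiI p.1, expTwoPiI (p.1 - p.2))) (by fun_prop)
      fun p hp => norm_expTwoPiI_lt_one hp

theorem differentiable_oddTheta {τ : ℂ} (hτ : 0 < τ.im) : Differentiable ℂ (oddTheta τ) := by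
  intro z
  have h := differentiableOn_oddTheta.differentiableAt
    (isOpen_im_fst_pos.mem_nhds (show (τ, z) ∈ {p : ℂ × ℂ | 0 < p.1.im} from hτ))
  exact h.comp z (f := fun z : ℂ => (τ, z)) (by fun_prop)

/-- The factor 1 - e(z), which vanishes at 0, is isolated. The remaining product of two Pochhammer
symbols is even in z, so oddness and the derivative at 0 become visible. -/
theorem oddTheta_eq {τ : ℂ} (hτ : 0 < τ.im) (z : ℂ) :
    oddTheta τ z = (1 - expTwoPiI z) * (expTwoPiI (-z / 2) *
      (qPochhammer (expTwoPiI τ) (expTwoPiI (τ + z)) *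
        qPochhammer (expTwoPiI τ) (expTwoPiI (τ - z)))) := by
  unfold oddTheta
  rw [qPochhammer_eq_mul (norm_expTwoPiI_lt_one hτ) (expTwoPiI z), ← expTwoPiI_add]
  ring

theorem oddTheta_neg {τ : ℂ} (hτ : 0 < τ.im) (z : ℂ) : oddTheta τ (-z) = -oddTheta τ z := by
  rw [oddTheta_eq hτ, oddTheta_eq hτ, sub_neg_eq_add, ← sub_eq_add_neg]
  have h1 : expTwoPiI (- -z / 2) = expTwoPiI z * expTwoPiI (-z / 2) := by
    rw [← expTwoPiI_add]; congr 1; ring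
  have h2 : expTwoPiI z ≠ 0 := expTwoPiI_ne_zero z
  rw [h1, expTwoPiI_neg]
  field_simp
  ring

theorem oddTheta_add_one (τ z : ℂ) : oddTheta τ (z + 1) = -oddTheta τ z := by
  unfold oddTheta
  have h1 : expTwoPiI (-(z + 1) / 2) = -expTwoPiI (-z / 2) := by
    have : -(z + 1) / 2 = -z / 2 + -(1 / 2) := by ring
    rw [this, expTwoPiI_add]
    have h2 : expTwoPiI (-(1 / 2)) = -1 := by
      unfold expTwoPiI
      rw [show 2 * (Real.pi : ℂ) * Complex.I * (-(1 / 2)) = -(Real.pi * Complex.I) by ring, Complex.exp_neg,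
        Complex.exp_pi_mul_I]
      norm_num
    rw [h2]; ring
  have h3 : τ - (z + 1) = τ - z + -1 := by ring
  rw [h1, h3, expTwoPiI_add, expTwoPiI_add, expTwoPiI_neg, expTwoPiI_one]
  ring_nf

theorem oddTheta_add_tau {τ : ℂ} (hτ : 0 < τ.im) (z : ℂ) :
    oddTheta τ (z + τ) = -expTwoPiI (-τ / 2 - z) * oddTheta τ z := by
  have hq := norm_expTwoPiI_lt_one hτ
  have hz := expTwoPiI_ne_zero z
  have e1 : oddTheta τ z = expTwoPiI (-z / 2) * ((1 - expTwoPiI z) *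
      qPochhammer (expTwoPiI τ) (expTwoPiI (τ + z)) *
        qPochhammer (expTwoPiI τ) (expTwoPiI (τ - z))) := by
    rw [oddTheta_eq hτ]; ring
  have e2 : oddTheta τ (z + τ) = expTwoPiI (-(z + τ) / 2) *
      (qPochhammer (expTwoPiI τ) (expTwoPiI (τ + z)) * ((1 - expTwoPiI (-z)) *
        qPochhammer (expTwoPiI τ) (expTwoPiI (τ - z)))) := by
    unfold oddTheta
    rw [show τ - (z + τ) = -z by ring, qPochhammer_eq_mul hq (expTwoPiI (-z)), ← expTwoPiI_add,
      ← sub_eq_add_neg, add_comm z τ]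
  have e3 : expTwoPiI (-(z + τ) / 2) * (1 - expTwoPiI (-z)) =
      -expTwoPiI (-τ / 2 - z) * expTwoPiI (-z / 2) * (1 - expTwoPiI z) := by
    have h1 : -(z + τ) / 2 = -τ / 2 + -z / 2 := by ring
    have h2 : -τ / 2 - z = -τ / 2 + -z := by ring
    rw [h1, h2, expTwoPiI_add, expTwoPiI_add, expTwoPiI_neg]
    field_simp
    ring
  rw [e1, e2]
  linear_combination (qPochhammer (expTwoPiI τ) (expTwoPiI (τ + z)) *
    qPochhammer (expTwoPiI τ) (expTwoPiI (τ - z))) * e3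

theorem mem_lattice_periodPair {τ : ℍ} {z : ℂ} :
    z ∈ (periodPair τ).lattice ↔ ∃ m n : ℤ, z = m + n * τ := by
  rw [PeriodPair.mem_lattice]
  simp only [periodPair, mul_one, eq_comm]

/-- The zeros m + nτ with n ≤ 0 come from the Pochhammer symbol in e(z), those with n > 0 from the
one in e(τ - z). -/
theorem oddTheta_eq_zero_iff (τ : ℍ) (z : ℂ) :
    oddTheta τ z = 0 ↔ z ∈ (periodPair τ).lattice := by
  have hq := norm_expTwoPiI_lt_one τ.im_pos
  rw [mem_lattice_periodPair]
  unfold oddTheta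
  simp only [mul_eq_zero, expTwoPiI_ne_zero, false_or, qPochhammer_eq_zero_iff hq,
    expTwoPiI_natMul, ← expTwoPiI_add, expTwoPiI_eq_one_iff]
  constructor
  · rintro (⟨n, m, h⟩ | ⟨n, m, h⟩)
    · exact ⟨m, -n, by push_cast; linear_combination h⟩
    · exact ⟨-m, n + 1, by push_cast; linear_combination -h⟩
  · rintro ⟨m, n, rfl⟩
    rcases le_or_gt n 0 with hn | hn
    · obtain ⟨k, rfl⟩ := Int.exists_eq_neg_ofNat hn
      exact Or.inl ⟨k, m, by push_cast; ring⟩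
    · obtain ⟨k, rfl⟩ : ∃ k : ℕ, n = k + 1 := ⟨(n - 1).toNat, by omega⟩
      exact Or.inr ⟨k, -m, by push_cast; ring⟩

/-- The right side is -2πi ∏ (1 - qⁿ)² over n ≥ 1, whose twelfth power matches the product formula
of the discriminant up to the factor q. -/
theorem deriv_oddTheta_zero {τ : ℂ} (hτ : 0 < τ.im) :
    deriv (oddTheta τ) 0 = -(2 * Real.pi * Complex.I) * qPochhammer (expTwoPiI τ) (expTwoPiI τ) ^ 2 := by
  have hd : DifferentiableAt ℂ (fun z => expTwoPiI (-z / 2) *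
      (qPochhammer (expTwoPiI τ) (expTwoPiI (τ + z)) *
        qPochhammer (expTwoPiI τ) (expTwoPiI (τ - z)))) 0 := by
    have he := differentiable_expTwoPiI
    have hP : Differentiable ℂ (qPochhammer (expTwoPiI τ)) := fun w =>
      (differentiableOn_qPochhammer.differentiableAt
        ((isOpen_lt (by fun_prop) continuous_const).mem_nhds
          (show (expTwoPiI τ, w) ∈ {p : ℂ × ℂ | ‖p.1‖ < 1} from norm_expTwoPiI_lt_one hτ))).comp w
        (f := fun w : ℂ => (expTwoPiI τ, w)) (by fun_prop)
    fun_prop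
  have h := ((hasDerivAt_expTwoPiI 0).const_sub 1).mul hd.hasDerivAt
  have he : oddTheta τ = _ := funext (oddTheta_eq hτ)
  rw [he]
  refine h.deriv.trans ?_
  simp [expTwoPiI_zero]
  ring

theorem deriv_oddTheta_zero_ne_zero {τ : ℂ} (hτ : 0 < τ.im) : deriv (oddTheta τ) 0 ≠ 0 := by
  have hq := norm_expTwoPiI_lt_one hτ
  rw [deriv_oddTheta_zero hτ]
  refine mul_ne_zero (neg_ne_zero.2 Complex.two_pi_I_ne_zero) (pow_ne_zero 2 fun h => ?_)
  obtain ⟨n, hn⟩ := (qPochhammer_eq_zero_iff hq _).1 h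
  have h1 := congrArg norm hn
  rw [← pow_succ, norm_pow, norm_one] at h1
  exact (pow_lt_one₀ (norm_nonneg _) hq (Nat.succ_ne_zero n)).ne h1

/-- The multiplier of the theta function under translation by a lattice vector. -/
theorem exists_oddTheta_add {τ : ℍ} {l : ℂ} (hl : l ∈ (periodPair τ).lattice) :
    ∃ a b : ℂ, ∀ z, oddTheta τ (z + l) = exp (a * z + b) * oddTheta τ z := by
  have hneg : ∀ l : ℂ, (∃ a b : ℂ, ∀ z, oddTheta τ (z + l) = exp (a * z + b) * oddTheta τ z) →
      ∃ a b : ℂ, ∀ z, oddTheta τ (z + -l) = exp (a * z + b) * oddTheta τ z := by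
    rintro l ⟨a, b, h⟩
    refine ⟨-a, a * l - b, fun z => ?_⟩
    have := h (z + -l)
    rw [neg_add_cancel_right] at this
    rw [this, ← mul_assoc, ← Complex.exp_add]
    ring_nf
    simp
  unfold PeriodPair.lattice at hl
  induction hl using Submodule.span_induction with
  | mem x hx =>
    rcases hx with rfl | rfl
    · refine ⟨0, Real.pi * Complex.I, fun z => ?_⟩
      change oddTheta τ (z + 1) = _
      rw [oddTheta_add_one, zero_mul, zero_add, Complex.exp_pi_mul_I]
      ring
    · refine ⟨-(2 * Real.pi * Complex.I), -(Real.pi * Complex.I * τ) + Real.pi * Complex.I, fun z => ?_⟩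
      change oddTheta τ (z + τ) = _
      rw [oddTheta_add_tau τ.im_pos, ← add_assoc, Complex.exp_add _ (Real.pi * Complex.I),
        Complex.exp_pi_mul_I, expTwoPiI]
      ring_nf
  | zero => exact ⟨0, 0, fun z => by simp⟩
  | add x y _ _ hx hy =>
    obtain ⟨a, b, h⟩ := hx
    obtain ⟨a', b', h'⟩ := hy
    refine ⟨a + a', b + b' + a' * x, fun z => ?_⟩
    rw [← add_assoc, h', h, ← mul_assoc, ← Complex.exp_add]
    ring_nf
  | smul n x _ hx =>
    have hnat : ∀ n : ℕ, ∃ a b : ℂ, ∀ z, oddTheta τ (z + (n : ℤ) • x) =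
        exp (a * z + b) * oddTheta τ z := by
      intro n
      induction n with
      | zero => exact ⟨0, 0, fun z => by simp⟩
      | succ n ih =>
        obtain ⟨a, b, h⟩ := hx
        obtain ⟨a', b', h'⟩ := ih
        refine ⟨a + a', b + b' + a' * x, fun z => ?_⟩
        have e : z + ((n + 1 : ℕ) : ℤ) • x = (z + x) + (n : ℤ) • x := by
          simp; ring
        rw [e, h', h, ← mul_assoc, ← Complex.exp_add]
        ring_nf
    rcases le_total 0 n with hn | hn
    · lift n to ℕ using hn
      exact hnat n
    · obtain ⟨k, rfl⟩ := Int.exists_eq_neg_ofNat hn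
      rw [_root_.neg_smul]
      exact hneg _ (hnat k)

theorem deriv_oddTheta_ne_zero {τ : ℍ} {l : ℂ} (hl : l ∈ (periodPair τ).lattice) :
    deriv (oddTheta τ) l ≠ 0 := by
  obtain ⟨a, b, h⟩ := exists_oddTheta_add hl
  have h0 : oddTheta τ 0 = 0 := (oddTheta_eq_zero_iff τ 0).2 (zero_mem _)
  have hd := differentiable_oddTheta τ.im_pos
  have h1 : HasDerivAt (fun z => exp (a * z + b) * oddTheta τ z)
      (exp (a * 0 + b) * deriv (oddTheta τ) 0) 0 := by
    have hE : DifferentiableAt ℂ (fun z : ℂ => exp (a * z + b)) 0 := by fun_prop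
    refine (hE.hasDerivAt.mul (hd 0).hasDerivAt).congr_deriv ?_
    simp [h0]
  have h2 : HasDerivAt (fun z => oddTheta τ (z + l)) (deriv (oddTheta τ) l) 0 := by
    have h3 : HasDerivAt (oddTheta τ) (deriv (oddTheta τ) l) (0 + l) := by
      rw [zero_add]; exact (hd l).hasDerivAt
    exact h3.comp_add_const 0 l
  rw [funext h] at h2
  rw [h2.unique h1]
  exact mul_ne_zero (Complex.exp_ne_zero _) (deriv_oddTheta_zero_ne_zero τ.im_pos)

end Theta

/-! ### Liouville's theorem for elliptic functions. -/

section EllipticLiouville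

/-- An elliptic function with only removable singularities extends to a bounded entire function.
Punctured neighbourhoods appear because the values of F at the singularities are arbitrary, as when
a quotient is 0 by division by zero. -/
theorem PeriodPair.eventually_eq_const_of_removable (L : PeriodPair) {F : ℂ → ℂ}
    (hper : ∀ z, ∀ l ∈ L.lattice, F (z + l) = F z)
    (hloc : ∀ x, ∃ g : ℂ → ℂ, AnalyticAt ℂ g x ∧ F =ᶠ[𝓝[≠] x] g) :
    ∃ C : ℂ, ∀ x, F =ᶠ[𝓝[≠] x] fun _ => C := by
  choose g hg hFg using hloc
  -- The local extensions agree on punctured neighbourhoods, hence by continuity at the centres too,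
  -- so their diagonal values form one entire function.
  set G : ℂ → ℂ := fun x => g x x with hGdef
  have hG : ∀ x, G =ᶠ[𝓝 x] g x := by
    intro x
    refine eventuallyEq_nhds_of_eventuallyEq_nhdsNE ?_ rfl
    filter_upwards [eventually_eventually_nhdsWithin.2 (hFg x), self_mem_nhdsWithin,
      (hg x).eventually_analyticAt.filter_mono nhdsWithin_le_nhds] with y hy hyx hga
    rw [IsOpen.nhdsWithin_eq isOpen_compl_singleton hyx] at hy
    have h1 : g y =ᶠ[𝓝[≠] y] g x := (hFg y).symm.trans (hy.filter_mono nhdsWithin_le_nhds)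
    exact (((hg y).continuousAt.eventuallyEq_nhds_iff_eventuallyEq_nhdsNE hga.continuousAt).1
      h1).self_of_nhds
  have hGa : ∀ x, AnalyticAt ℂ G x := fun x => (hg x).congr (hG x).symm
  have hFG : ∀ x, F =ᶠ[𝓝[≠] x] G := fun x =>
    (hFg x).trans ((hG x).symm.filter_mono nhdsWithin_le_nhds)
  have hGper : ∀ z, ∀ l ∈ L.lattice, G (z + l) = G z := by
    intro z l hl
    have hmap : Filter.Tendsto (fun y : ℂ => y + l) (𝓝[≠] z) (𝓝[≠] (z + l)) := by
      refine tendsto_nhdsWithin_iff.2 ⟨((continuous_add_const l).tendsto z).mono_left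
        nhdsWithin_le_nhds, ?_⟩
      filter_upwards [self_mem_nhdsWithin] with y hy
      simpa using hy
    have h1 : (fun y => G (y + l)) =ᶠ[𝓝[≠] z] G := by
      filter_upwards [hmap.eventually (hFG (z + l)), hFG z] with y hy hy'
      rw [← hy, hper y l hl, hy']
    have hc : ContinuousAt (fun y => G (y + l)) z :=
      (hGa (z + l)).continuousAt.comp (f := fun y : ℂ => y + l) (by fun_prop)
    exact ((hc.eventuallyEq_nhds_iff_eventuallyEq_nhdsNE (hGa z).continuousAt).1 h1).self_of_nhds
  have hGd : Differentiable ℂ G := fun x => (hGa x).differentiableAt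
  refine ⟨G 0, fun x => (hFG x).trans (Filter.Eventually.of_forall fun y => ?_)⟩
  exact hGd.apply_eq_apply_of_bounded (IsZLattice.isCompact_range_of_periodic L.lattice G
    hGd.continuous hGper).isBounded y 0

theorem AnalyticAt.dslope_self {f : ℂ → ℂ} {x : ℂ} (hf : AnalyticAt ℂ f x) :
    AnalyticAt ℂ (dslope f x) x := by
  obtain ⟨p, hp⟩ := hf
  exact ⟨_, hp.has_fpower_series_dslope_fslope⟩

theorem eq_sub_mul_dslope {f : ℂ → ℂ} {x : ℂ} (h : f x = 0) (y : ℂ) :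
    f y = (y - x) * dslope f x y := by
  have := sub_smul_dslope f x y
  simpa [h] using this.symm

/-- At such a point -x ≡ x modulo the lattice, while ℘' is odd. -/
theorem PeriodPair.derivWeierstrassP_eq_zero_of_two_mul_mem (L : PeriodPair) {x : ℂ}
    (hx : 2 * x ∈ L.lattice) : L.derivWeierstrassP x = 0 := by
  have h1 := L.derivWeierstrassP_sub_coe x ⟨2 * x, hx⟩
  rw [show x - ((⟨2 * x, hx⟩ : L.lattice) : ℂ) = -x by simp; ring, L.derivWeierstrassP_neg] at h1
  linear_combination -(1 / 2 : ℂ) * h1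

end EllipticLiouville

/-! ### The duplication formula for theta and ℘'. -/

section Duplication

open Complex (exp)

theorem one_half_notMem_lattice (τ : ℍ) : (1 / 2 : ℂ) ∉ (periodPair τ).lattice :=
  (periodPair τ).ω₁_div_two_notMem_lattice

/-- With multiplier exp(az + b), the fourth power contributes exp(4(az + b)) and doubling
contributes the same times exp(al - 2b). Oddness of theta, tested at the point 1/2 where theta does
not vanish, gives exp(2b - al) = 1. -/
theorem exists_oddTheta_add_of_two_mul {τ : ℍ} {l : ℂ} (hl : l ∈ (periodPair τ).lattice) (z : ℂ) :
    ∃ c : ℂ, c ≠ 0 ∧ oddTheta τ (z + l) ^ 4 = c * oddTheta τ z ^ 4 ∧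
      oddTheta τ (2 * (z + l)) = c * oddTheta τ (2 * z) := by
  obtain ⟨a, b, h⟩ := exists_oddTheta_add hl
  have hexp : exp (2 * b - a * l) = 1 := by
    have h0 : oddTheta τ (1 / 2) ≠ 0 := fun h0 =>
      one_half_notMem_lattice τ ((oddTheta_eq_zero_iff τ _).1 h0)
    have h1 := h (-(1 / 2) - l)
    rw [sub_add_cancel, show -(1 / 2) - l = -(1 / 2 + l) by ring, oddTheta_neg τ.im_pos,
      oddTheta_neg τ.im_pos, h (1 / 2)] at h1
    have h2 : oddTheta τ (1 / 2) * 1 = oddTheta τ (1 / 2) * exp (2 * b - a * l) := by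
      rw [show 2 * b - a * l = (a * -(1 / 2 + l) + b) + (a * (1 / 2) + b) by ring, Complex.exp_add]
      linear_combination -h1
    exact (mul_left_cancel₀ h0 h2).symm
  refine ⟨exp (4 * (a * z + b)), Complex.exp_ne_zero _, ?_, ?_⟩
  · rw [h, mul_pow, ← Complex.exp_nat_mul]
    norm_num
  · rw [show 2 * (z + l) = (2 * z + l) + l by ring, h, h, ← mul_assoc, ← Complex.exp_add,
      show a * (2 * z + l) + b + (a * (2 * z) + b) = 4 * (a * z + b) + -(2 * b - a * l) by ring,
      Complex.exp_add, Complex.exp_neg, hexp]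
    simp

/-- The quotient of the two sides of the duplication formula. -/
def duplicationQuotient (τ : ℍ) (z : ℂ) : ℂ :=
  (periodPair τ).derivWeierstrassP z * oddTheta τ z ^ 4 / oddTheta τ (2 * z)

theorem duplicationQuotient_add (τ : ℍ) (z : ℂ) {l : ℂ} (hl : l ∈ (periodPair τ).lattice) :
    duplicationQuotient τ (z + l) = duplicationQuotient τ z := by
  obtain ⟨c, hc, h1, h2⟩ := exists_oddTheta_add_of_two_mul hl z
  unfold duplicationQuotient
  rw [h1, h2, show (periodPair τ).derivWeierstrassP (z + l) = _ from
    (periodPair τ).derivWeierstrassP_add_coe z ⟨l, hl⟩, mul_left_comm, mul_div_mul_left _ _ hc]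

theorem analyticAt_oddTheta (τ : ℍ) (z : ℂ) : AnalyticAt ℂ (oddTheta τ) z :=
  (differentiable_oddTheta τ.im_pos).analyticAt z

theorem oddTheta_zero (τ : ℍ) : oddTheta τ 0 = 0 := (oddTheta_eq_zero_iff τ 0).2 (zero_mem _)

theorem exists_analyticAt_duplicationQuotient_zero (τ : ℍ) :
    ∃ g : ℂ → ℂ, AnalyticAt ℂ g 0 ∧ duplicationQuotient τ =ᶠ[𝓝[≠] 0] g ∧
      g 0 = -deriv (oddTheta τ) 0 ^ 3 := by
  set L := periodPair τ
  set t : ℂ → ℂ := dslope (oddTheta τ) 0 with ht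
  have hta : AnalyticAt ℂ t 0 := (analyticAt_oddTheta τ 0).dslope_self
  have ht0 : t 0 = deriv (oddTheta τ) 0 := dslope_same _ _
  have hne : t 0 ≠ 0 := by rw [ht0]; exact deriv_oddTheta_zero_ne_zero τ.im_pos
  have hta2 : AnalyticAt ℂ (fun z => t (2 * z)) 0 := by
    have h2 : AnalyticAt ℂ t (2 * 0) := by rwa [mul_zero]
    exact h2.comp (f := fun z : ℂ => 2 * z) (by fun_prop)
  have hE : AnalyticAt ℂ (L.derivWeierstrassPExcept 0) 0 := L.analyticAt_derivWeierstrassPExcept 0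
  -- Substitute θ(z) = z t(z) and ℘'(z) = -2/z³ + (regular part), then cancel the powers of z; the
  -- value at 0 is -2 t(0)⁴ / (2 t(0)).
  refine ⟨fun z => (z ^ 3 * L.derivWeierstrassPExcept 0 z - 2) * t z ^ 4 / (2 * t (2 * z)), ?_, ?_, ?_⟩
  · refine AnalyticAt.div (by fun_prop) (analyticAt_const.mul hta2) ?_
    simpa using hne
  · filter_upwards [self_mem_nhdsWithin,
      (hta2.continuousAt.eventually_ne (by simpa using hne)).filter_mono nhdsWithin_le_nhds]
      with z hz ht2
    have hz : z ≠ 0 := hz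
    have h1 := L.derivWeierstrassPExcept_def 0 z
    simp only [ZeroMemClass.coe_zero, sub_zero] at h1
    unfold duplicationQuotient
    rw [h1, eq_sub_mul_dslope (oddTheta_zero τ) z, eq_sub_mul_dslope (oddTheta_zero τ) (2 * z),
      ← ht]
    simp only [sub_zero]
    field_simp
    ring
  · simp only [mul_zero, ht0]
    have := deriv_oddTheta_zero_ne_zero τ.im_pos
    field_simp
    ring

/-- Lattice points reduce to 0 by periodicity. At the other half periods, the zero of ℘' cancels the
simple zero of θ(2z). Elsewhere the denominator does not vanish. -/
theorem exists_analyticAt_duplicationQuotient (τ : ℍ) (x : ℂ) :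
    ∃ g : ℂ → ℂ, AnalyticAt ℂ g x ∧ duplicationQuotient τ =ᶠ[𝓝[≠] x] g := by
  set L := periodPair τ
  have hθ2 : AnalyticAt ℂ (fun z => oddTheta τ (2 * z)) x :=
    (analyticAt_oddTheta τ (2 * x)).comp (f := fun z : ℂ => 2 * z) (by fun_prop)
  by_cases hx : x ∈ L.lattice
  · obtain ⟨g, hg, hFg, -⟩ := exists_analyticAt_duplicationQuotient_zero τ
    refine ⟨fun z => g (z - x), ?_, ?_⟩
    · have h0 : AnalyticAt ℂ g (x - x) := by rwa [sub_self]
      exact h0.comp (f := fun z : ℂ => z - x) (by fun_prop)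
    · have hmap : Filter.Tendsto (fun y : ℂ => y - x) (𝓝[≠] x) (𝓝[≠] 0) := by
        refine tendsto_nhdsWithin_iff.2 ⟨?_, ?_⟩
        · have : ContinuousAt (fun y : ℂ => y - x) x := by fun_prop
          simpa using this.tendsto.mono_left nhdsWithin_le_nhds
        · filter_upwards [self_mem_nhdsWithin] with y hy
          simpa [sub_eq_zero] using hy
      filter_upwards [hmap.eventually hFg] with y hy
      rw [← hy, ← duplicationQuotient_add τ (y - x) hx, sub_add_cancel]
  have h℘ : AnalyticAt ℂ L.derivWeierstrassP x := L.analyticOnNhd_derivWeierstrassP x hx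
  have hθ := analyticAt_oddTheta τ x
  by_cases h2x : 2 * x ∈ L.lattice
  · have h1 := L.derivWeierstrassP_eq_zero_of_two_mul_mem h2x
    have h2 : oddTheta τ (2 * x) = 0 := (oddTheta_eq_zero_iff τ _).2 h2x
    have hd1 := h℘.dslope_self
    have hd2 := hθ2.dslope_self
    have hne : dslope (fun z => oddTheta τ (2 * z)) x x ≠ 0 := by
      rw [dslope_same]
      have h3 : HasDerivAt (fun z => oddTheta τ (2 * z)) (deriv (oddTheta τ) (2 * x) * 2) x :=
        ((differentiable_oddTheta τ.im_pos) (2 * x)).hasDerivAt.comp x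
          (by simpa using (hasDerivAt_id x).const_mul (2 : ℂ))
      rw [h3.deriv]
      exact mul_ne_zero (deriv_oddTheta_ne_zero h2x) two_ne_zero
    refine ⟨fun z => dslope L.derivWeierstrassP x z * oddTheta τ z ^ 4 /
      dslope (fun z => oddTheta τ (2 * z)) x z, (hd1.mul (hθ.pow 4)).div hd2 hne, ?_⟩
    filter_upwards [self_mem_nhdsWithin] with z hz
    have hz : z - x ≠ 0 := sub_ne_zero.2 hz
    unfold duplicationQuotient
    rw [eq_sub_mul_dslope h1 z, eq_sub_mul_dslope (f := fun z => oddTheta τ (2 * z)) h2 z,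
      mul_assoc, mul_div_mul_left _ _ hz]
  · refine ⟨duplicationQuotient τ, (h℘.mul (hθ.pow 4)).div hθ2 ?_, Filter.EventuallyEq.rfl⟩
    exact fun h => h2x ((oddTheta_eq_zero_iff τ _).1 h)

/-- The quotient of the two sides is elliptic with removable singularities, hence constant; the
constant is its limit at 0. -/
theorem derivWeierstrassP_mul_oddTheta_pow (τ : ℍ) {z : ℂ}
    (hz : 2 * z ∉ (periodPair τ).lattice) :
    (periodPair τ).derivWeierstrassP z * oddTheta τ z ^ 4 =
      -deriv (oddTheta τ) 0 ^ 3 * oddTheta τ (2 * z) := by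
  obtain ⟨C, hC⟩ := (periodPair τ).eventually_eq_const_of_removable
    (fun z l hl => duplicationQuotient_add τ z hl) (exists_analyticAt_duplicationQuotient τ)
  obtain ⟨g, hg, hFg, hg0⟩ := exists_analyticAt_duplicationQuotient_zero τ
  have hCg : g 0 = C := ((hg.continuousAt.eventuallyEq_nhds_iff_eventuallyEq_nhdsNE
    continuousAt_const).1 (hFg.symm.trans (hC 0))).self_of_nhds
  have hne : oddTheta τ (2 * z) ≠ 0 := fun h => hz ((oddTheta_eq_zero_iff τ _).1 h)
  have hzL : z ∉ (periodPair τ).lattice := fun h => hz (by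
    simpa [two_mul] using add_mem h h)
  have hFa : ContinuousAt (duplicationQuotient τ) z :=
    ((((periodPair τ).analyticOnNhd_derivWeierstrassP z hzL).mul
      ((analyticAt_oddTheta τ z).pow 4)).div ((analyticAt_oddTheta τ (2 * z)).comp
        (f := fun z : ℂ => 2 * z) (by fun_prop)) hne).continuousAt
  have hFz : duplicationQuotient τ z = C :=
    ((hFa.eventuallyEq_nhds_iff_eventuallyEq_nhdsNE continuousAt_const).1 (hC z)).self_of_nhds
  rw [← hg0, hCg, ← hFz, duplicationQuotient, div_mul_cancel₀ _ hne]

end Duplication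

/-! ### The discriminant of the lattice as an infinite product. -/

section LatticeDiscriminant

open EisensteinSeries in
theorem PeriodPair.G_periodPair (τ : ℍ) {k : ℕ} (hk : 3 ≤ k) :
    (periodPair τ).G k = 2 * riemannZeta k * ModularForm.E hk τ := by
  have h1 : ModularForm.E hk τ = (1 / 2 : ℂ) * eisensteinSeries (N := 1) 0 k τ := rfl
  have h2 := tsum_eisSummand_eq_riemannZeta_mul_eisensteinSeries hk τ
  have h3 : (periodPair τ).G k = ∑' v : Fin 2 → ℤ, eisSummand k v τ := by
    unfold PeriodPair.G
    let e : (Fin 2 → ℤ) ≃ (periodPair τ).lattice :=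
      ((finTwoArrowEquiv ℤ).trans (Equiv.prodComm ℤ ℤ)).trans
        (periodPair τ).latticeEquivProd.symm.toEquiv
    rw [← e.tsum_eq]
    refine tsum_congr fun v => ?_
    have he : ((e v : (periodPair τ).lattice) : ℂ) = v 0 * τ + v 1 := by
      have := (periodPair τ).latticeEquiv_symm_apply (v 1, v 0)
      simp only [periodPair, mul_one] at this
      rw [add_comm, ← this]
      rfl
    rw [he, eisSummand, zpow_neg, zpow_natCast]
  rw [h3, h2, h1]
  ring

theorem riemannZeta_six : riemannZeta 6 = (Real.pi : ℂ) ^ 6 / 945 := by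
  have h := riemannZeta_two_mul_nat (k := 3) (by norm_num)
  rw [show (2 * ((3 : ℕ) : ℂ)) = 6 by norm_num] at h
  rw [h]
  have hb : bernoulli 6 = 1 / 42 := by
    have h5 : bernoulli' 5 = 0 := bernoulli'_eq_zero_of_odd (by decide) (by norm_num)
    rw [bernoulli_eq_bernoulli'_of_ne_one (by norm_num), bernoulli'_def]
    norm_num [Finset.sum_range_succ, Nat.choose, bernoulli'_zero, bernoulli'_one, bernoulli'_two,
      bernoulli'_three, bernoulli'_four, h5]
  norm_num [hb, Nat.factorial]
  ring

/-- The values of ζ(4) and ζ(6) give g₂ = (4/3) π⁴ E₄ and g₃ = (8/27) π⁶ E₆. -/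
theorem latticeDiscr_eq_discriminant (τ : ℍ) :
    latticeDiscr τ = (2 * Real.pi) ^ 12 * ModularForm.discriminant τ := by
  have h4 := PeriodPair.G_periodPair τ (k := 4) (by norm_num)
  have h6 := PeriodPair.G_periodPair τ (k := 6) (by norm_num)
  rw [show ((4 : ℕ) : ℂ) = 4 by norm_num, riemannZeta_four] at h4
  rw [show ((6 : ℕ) : ℂ) = 6 by norm_num, riemannZeta_six] at h6
  rw [latticeDiscr, PeriodPair.g₂, PeriodPair.g₃, h4, h6,
    ModularForm.discriminant_eq_E₄_cube_sub_E₆_sq]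
  ring

/-- Compare Δ = (2π)¹² q ∏ (1 - qⁿ)²⁴ with |θ'(0)| = 2π |∏ (1 - qⁿ)|². The leftover |q| determines
the additive constant of the height. -/
theorem norm_latticeDiscr (τ : ℍ) : ‖latticeDiscr τ‖ =
    Real.exp (-(2 * Real.pi * τ.im)) * ‖deriv (oddTheta τ) 0‖ ^ 12 := by
  have hq : Function.Periodic.qParam 1 (τ : ℂ) = expTwoPiI τ := by
    simp [Function.Periodic.qParam, expTwoPiI]
  have hP : ∏' n, (1 - ModularForm.eta_q n τ) ^ 24 =
      qPochhammer (expTwoPiI τ) (expTwoPiI τ) ^ 24 := by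
    have hm := multipliable_qPochhammer (norm_expTwoPiI_lt_one τ.im_pos) (expTwoPiI τ)
    unfold qPochhammer
    rw [← hm.tprod_pow]
    refine tprod_congr fun n => ?_
    rw [ModularForm.eta_q, hq, pow_succ (expTwoPiI _) n, ← sub_eq_add_neg]
  rw [latticeDiscr_eq_discriminant, ModularForm.discriminant_eq_q_prod, hP, hq,
    deriv_oddTheta_zero τ.im_pos, norm_mul, norm_mul, norm_expTwoPiI]
  simp only [norm_pow, norm_mul, norm_neg, Complex.norm_I, mul_one]
  have : (τ : ℂ).im = τ.im := rfl
  rw [this]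
  ring

theorem norm_latticeDiscr_pos (τ : ℍ) : 0 < ‖latticeDiscr τ‖ := by
  rw [norm_latticeDiscr]
  have := norm_pos_iff.2 (deriv_oddTheta_zero_ne_zero τ.im_pos)
  positivity

end LatticeDiscriminant

/-! ### Homogeneity of ℘, ℘' and Eisenstein sums under scaling of the lattice. -/

section Scaling

variable {L L' : PeriodPair} {d : ℂ}

/-- Multiplication by `d⁻¹` as a bijection of lattices. -/
def PeriodPair.latticeScale (hd : d ≠ 0) (h : ∀ z, z ∈ L.lattice ↔ z / d ∈ L'.lattice) :
    L.lattice ≃ L'.lattice where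
  toFun l := ⟨l / d, (h l).1 l.2⟩
  invFun l := ⟨l * d, (h _).2 (by rw [mul_div_cancel_right₀ _ hd]; exact l.2)⟩
  left_inv l := by ext; exact div_mul_cancel₀ _ hd
  right_inv l := by ext; exact mul_div_cancel_right₀ _ hd

theorem PeriodPair.weierstrassP_div (hd : d ≠ 0) (h : ∀ z, z ∈ L.lattice ↔ z / d ∈ L'.lattice)
    (z : ℂ) : L'.weierstrassP (z / d) = d ^ 2 * L.weierstrassP z := by
  unfold PeriodPair.weierstrassP
  rw [← (PeriodPair.latticeScale hd h).tsum_eq, ← tsum_mul_left]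
  refine tsum_congr fun l => ?_
  change 1 / (z / d - l / d) ^ 2 - 1 / (l / d : ℂ) ^ 2 = _
  rw [← sub_div, div_pow, div_pow, one_div_div, one_div_div]
  ring

theorem PeriodPair.derivWeierstrassP_div (hd : d ≠ 0)
    (h : ∀ z, z ∈ L.lattice ↔ z / d ∈ L'.lattice) (z : ℂ) :
    L'.derivWeierstrassP (z / d) = d ^ 3 * L.derivWeierstrassP z := by
  unfold PeriodPair.derivWeierstrassP
  rw [← (PeriodPair.latticeScale hd h).tsum_eq, mul_neg, ← tsum_mul_left]
  congr 1
  refine tsum_congr fun l => ?_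
  change 2 / (z / d - l / d) ^ 3 = _
  rw [← sub_div, div_pow, div_div_eq_mul_div]
  ring

theorem PeriodPair.G_scale (hd : d ≠ 0) (h : ∀ z, z ∈ L.lattice ↔ z / d ∈ L'.lattice) (n : ℕ) :
    L'.G n = d ^ n * L.G n := by
  unfold PeriodPair.G
  rw [← (PeriodPair.latticeScale hd h).tsum_eq, ← tsum_mul_left]
  refine tsum_congr fun l => ?_
  change ((l / d : ℂ) ^ n)⁻¹ = _
  rw [div_pow, inv_div]
  ring

end Scaling

/-! ### Existence, uniqueness and explicit form of the Néron height. -/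

section NeronHeight

theorem two_mul_mem_lattice {L : PeriodPair} {z : ℂ} (hz : z ∈ L.lattice) :
    2 * z ∈ L.lattice := by
  simpa [two_mul] using add_mem hz hz

theorem notMem_lattice_of_two_mul {L : PeriodPair} {z : ℂ} (hz : 2 * z ∉ L.lattice) :
    z ∉ L.lattice := fun h => hz (two_mul_mem_lattice h)

theorem add_mem_lattice_iff {L : PeriodPair} {z l : ℂ} (hl : l ∈ L.lattice) :
    z + l ∈ L.lattice ↔ z ∈ L.lattice :=
  ⟨fun h => by simpa using sub_mem h hl, fun h => add_mem h hl⟩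

theorem PeriodPair.countable_lattice (L : PeriodPair) : (L.lattice : Set ℂ).Countable :=
  (L.latticeEquivProd.toEquiv.countable_iff.2 inferInstance : Countable L.lattice).to_set

theorem PeriodPair.eventually_notMem_lattice (L : PeriodPair) {x : ℂ} :
    ∀ᶠ z in 𝓝[≠] x, z ∉ L.lattice := by
  filter_upwards [nhdsWithin_le_nhds (L.compl_lattice_sdiff_singleton_mem_nhds x),
    self_mem_nhdsWithin] with z hz hzx hzL
  exact hz ⟨hzL, hzx⟩

theorem PeriodPair.dense_two_mul_notMem_lattice (L : PeriodPair) :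
    Dense {z : ℂ | 2 * z ∉ L.lattice} :=
  (L.countable_lattice.preimage (mul_right_injective₀ (two_ne_zero' ℂ))).dense_compl ℝ

/-- The translation invariant part of minus the logarithm of the norm of `oddTheta`. -/
def thetaGreen (τ : ℍ) (z : ℂ) : ℝ :=
  Real.pi * (z.im ^ 2 / τ.im) - Real.log ‖oddTheta τ z‖ + Real.pi * τ.im / 6

theorem oddTheta_ne_zero {τ : ℍ} {z : ℂ} (hz : z ∉ (periodPair τ).lattice) : oddTheta τ z ≠ 0 :=
  fun h => hz ((oddTheta_eq_zero_iff τ z).1 h)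

theorem thetaGreen_add_one (τ : ℍ) (z : ℂ) : thetaGreen τ (z + 1) = thetaGreen τ z := by
  simp [thetaGreen, oddTheta_add_one]

/-- The quadratic term grows by π (2 Im z + Im τ), the logarithm of the modulus of the theta
multiplier. Lattice points are excluded because there the logarithm has the default value log 0 = 0.
-/
theorem thetaGreen_add_tau (τ : ℍ) {z : ℂ} (hz : z ∉ (periodPair τ).lattice) :
    thetaGreen τ (z + τ) = thetaGreen τ z := by
  have h := norm_pos_iff.2 (oddTheta_ne_zero hz)
  have ht := τ.im_pos.ne'
  have hc : ((τ : ℂ) / 2).im = τ.im / 2 := by simp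
  unfold thetaGreen
  rw [oddTheta_add_tau τ.im_pos, norm_mul, norm_neg, norm_expTwoPiI,
    Real.log_mul (Real.exp_pos _).ne' h.ne', Real.log_exp]
  rw [neg_div, Complex.sub_im, Complex.neg_im, hc, Complex.add_im]
  change Real.pi * ((z.im + τ.im) ^ 2 / τ.im) - _ + _ = _
  field_simp
  ring

theorem thetaGreen_add {τ : ℍ} {z l : ℂ} (hl : l ∈ (periodPair τ).lattice)
    (hz : z ∉ (periodPair τ).lattice) : thetaGreen τ (z + l) = thetaGreen τ z := by
  suffices H : z + l ∉ (periodPair τ).lattice ∧ thetaGreen τ (z + l) = thetaGreen τ z from H.2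
  refine ⟨fun h => hz ((add_mem_lattice_iff hl).1 h), ?_⟩
  induction hl using Submodule.span_induction generalizing z with
  | mem x hx =>
    rcases hx with rfl | rfl
    · exact thetaGreen_add_one τ z
    · exact thetaGreen_add_tau τ hz
  | zero => simp
  | add x y hx hy ihx ihy =>
    rw [← add_assoc, ihy fun h => hz ((add_mem_lattice_iff hx).1 h), ihx hz]
  | smul n x hx ih =>
    have hpos : ∀ (m : ℕ) (z : ℂ), z ∉ (periodPair τ).lattice →
        thetaGreen τ (z + m * x) = thetaGreen τ z := by
      intro m
      induction m with
      | zero => simp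
      | succ m ihm =>
        intro z hz
        rw [show z + ((m + 1 : ℕ) : ℂ) * x = (z + x) + m * x by push_cast; ring,
          ihm _ fun h => hz ((add_mem_lattice_iff hx).1 h), ih hz]
    obtain ⟨m, rfl | rfl⟩ := n.eq_nat_or_neg
    · simpa using hpos m z hz
    · have hm : (m : ℤ) • x ∈ (periodPair τ).lattice := Submodule.smul_mem _ _ hx
      have := hpos m (z + (-(m : ℤ)) • x) fun h => hz ((add_mem_lattice_iff
        (Submodule.smul_mem _ _ hx)).1 h)
      rw [← this]
      congr 1
      simp

open Classical in
/-- The explicit Néron local height. -/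
def explicitNeronHeight (τ : ℍ) (z : ℂ) : ℝ :=
  if z ∈ (periodPair τ).lattice then 0 else thetaGreen τ z

theorem explicitNeronHeight_of_notMem {τ : ℍ} {z : ℂ} (hz : z ∉ (periodPair τ).lattice) :
    explicitNeronHeight τ z = thetaGreen τ z := if_neg hz

theorem continuousAt_thetaGreen {τ : ℍ} {z : ℂ} (hz : z ∉ (periodPair τ).lattice) :
    ContinuousAt (thetaGreen τ) z := by
  have h1 : ContinuousAt (oddTheta τ) z := (analyticAt_oddTheta τ z).continuousAt
  have h2 : ContinuousAt (fun z => Real.log ‖oddTheta τ z‖) z :=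
    h1.norm.log (norm_ne_zero_iff.2 (oddTheta_ne_zero hz))
  have h3 : ContinuousAt (fun z : ℂ => Real.pi * (z.im ^ 2 / τ.im)) z := by fun_prop
  exact (h3.sub h2).add continuousAt_const

/-- Near 0, theta is z times a nonvanishing function and ℘ is z⁻² times one, so the two logarithmic
singularities cancel. -/
theorem exists_tendsto_thetaGreen_sub (τ : ℍ) : ∃ c : ℝ, Filter.Tendsto
    (fun z => thetaGreen τ z - Real.log ‖(periodPair τ).weierstrassP z‖ / 2) (𝓝[≠] 0) (𝓝 c) := by
  set L := periodPair τ
  have hθ0 := deriv_oddTheta_zero_ne_zero τ.im_pos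
  have hE : AnalyticAt ℂ (L.weierstrassPExcept 0) 0 := L.analyticAt_weierstrassPExcept 0
  have ht : ContinuousAt (dslope (oddTheta τ) 0) 0 :=
    (analyticAt_oddTheta τ 0).dslope_self.continuousAt
  have hP : ContinuousAt (fun z => z ^ 2 * L.weierstrassPExcept 0 z + 1) 0 :=
    ((continuousAt_id.pow 2).mul hE.continuousAt).add continuousAt_const
  have hne1 : dslope (oddTheta τ) 0 0 ≠ 0 := by rwa [dslope_same]
  have hne2 : (fun z => z ^ 2 * L.weierstrassPExcept 0 z + 1) 0 ≠ 0 := by simp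
  have hc : ContinuousAt (fun z : ℂ => Real.pi * (z.im ^ 2 / τ.im)
      - Real.log ‖dslope (oddTheta τ) 0 z‖ + Real.pi * τ.im / 6
      - Real.log ‖z ^ 2 * L.weierstrassPExcept 0 z + 1‖ / 2) 0 := by
    have h3 : ContinuousAt (fun z : ℂ => Real.pi * (z.im ^ 2 / τ.im)) 0 := by fun_prop
    exact ((h3.sub (ht.norm.log (norm_ne_zero_iff.2 hne1))).add continuousAt_const).sub
      ((hP.norm.log (norm_ne_zero_iff.2 hne2)).div_const 2)
  refine ⟨_, (hc.tendsto.mono_left nhdsWithin_le_nhds).congr' ?_⟩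
  filter_upwards [self_mem_nhdsWithin, nhdsWithin_le_nhds (ht.eventually_ne hne1),
    nhdsWithin_le_nhds (hP.eventually_ne hne2)] with z hz h1 h2
  have hz : z ≠ 0 := hz
  have hzn := (norm_pos_iff.2 hz).ne'
  have hP' : L.weierstrassP z = (z ^ 2 * L.weierstrassPExcept 0 z + 1) / z ^ 2 := by
    have := L.weierstrassPExcept_def 0 z
    simp only [ZeroMemClass.coe_zero, sub_zero] at this
    rw [this]
    field_simp
    ring
  unfold thetaGreen
  rw [hP', eq_sub_mul_dslope (oddTheta_zero τ) z, sub_zero, norm_mul, norm_div, norm_pow,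
    Real.log_mul hzn (norm_ne_zero_iff.2 h1), Real.log_div (norm_ne_zero_iff.2 h2)
    (pow_ne_zero 2 hzn), Real.log_pow]
  push_cast
  ring

theorem derivWeierstrassP_ne_zero {τ : ℍ} {z : ℂ} (hz : 2 * z ∉ (periodPair τ).lattice) :
    (periodPair τ).derivWeierstrassP z ≠ 0 := by
  intro h
  have h1 := derivWeierstrassP_mul_oddTheta_pow τ hz
  rw [h, zero_mul] at h1
  exact mul_ne_zero (neg_ne_zero.2 (pow_ne_zero 3 (deriv_oddTheta_zero_ne_zero τ.im_pos)))
    (oddTheta_ne_zero hz) h1.symm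

/-- The logarithm of the duplication formula, with log |Δ| / 4 = 3 log |θ'(0)| - π Im τ / 2. An
additive constant κ must therefore satisfy κ = 4κ - π Im τ / 2, which explains π Im τ / 6. -/
theorem thetaGreen_two_mul {τ : ℍ} {z : ℂ} (hz : 2 * z ∉ (periodPair τ).lattice) :
    thetaGreen τ (2 * z) = 4 * thetaGreen τ z -
      Real.log ‖(periodPair τ).derivWeierstrassP z‖ + Real.log ‖latticeDiscr τ‖ / 4 := by
  have h1 := norm_ne_zero_iff.2 (oddTheta_ne_zero hz)
  have h2 := norm_ne_zero_iff.2 (oddTheta_ne_zero (notMem_lattice_of_two_mul hz))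
  have h3 := norm_ne_zero_iff.2 (derivWeierstrassP_ne_zero hz)
  have h4 := norm_ne_zero_iff.2 (deriv_oddTheta_zero_ne_zero τ.im_pos)
  have h5 := congrArg (fun x => Real.log ‖x‖) (derivWeierstrassP_mul_oddTheta_pow τ hz)
  simp only [norm_mul, norm_neg, norm_pow] at h5
  rw [Real.log_mul h3 (pow_ne_zero 4 h2), Real.log_mul (pow_ne_zero 3 h4) h1, Real.log_pow,
    Real.log_pow] at h5
  rw [norm_latticeDiscr, Real.log_mul (Real.exp_pos _).ne' (pow_ne_zero 12 h4), Real.log_exp,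
    Real.log_pow]
  have h6 : (2 * z).im = 2 * z.im := by simp
  unfold thetaGreen
  rw [h6]
  push_cast at h5 ⊢
  linear_combination h5

theorem isNeronHeight_explicitNeronHeight (τ : ℍ) : IsNeronHeight τ (explicitNeronHeight τ) where
  periodic z l hl := by
    -- Periodicity is also required at lattice points, where `thetaGreen` fails to be periodic; the
    -- constant value 0 there restores it.
    by_cases hz : z ∈ (periodPair τ).lattice
    · simp [explicitNeronHeight, hz, add_mem hz hl]
    · rw [explicitNeronHeight_of_notMem hz, explicitNeronHeight_of_notMem
        fun h => hz ((add_mem_lattice_iff hl).1 h), thetaGreen_add hl hz]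
  continuousOn := ContinuousOn.congr
    (fun _ hz => (continuousAt_thetaGreen hz).continuousWithinAt)
    fun _ hz => explicitNeronHeight_of_notMem hz
  limit := by
    obtain ⟨c, hc⟩ := exists_tendsto_thetaGreen_sub τ
    refine ⟨c, hc.congr' ?_⟩
    filter_upwards [(periodPair τ).eventually_notMem_lattice] with z hz
    rw [explicitNeronHeight_of_notMem hz]
  duplication z hz := by
    rw [explicitNeronHeight_of_notMem hz,
      explicitNeronHeight_of_notMem (notMem_lattice_of_two_mul hz), thetaGreen_two_mul hz]

/-- A continuous periodic function is bounded, whereas D(2ⁿz) = 4ⁿ D(z) is unbounded unless D(z) =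
0. -/
theorem PeriodPair.eq_zero_of_periodic_of_two_mul (L : PeriodPair) {D : ℂ → ℝ} (hD : Continuous D)
    (hper : ∀ z, ∀ l ∈ L.lattice, D (z + l) = D z)
    (h2 : ∀ z, 2 * z ∉ L.lattice → D (2 * z) = 4 * D z) (z : ℂ) : D z = 0 := by
  -- The relation extends by density to the points whose double lies in the lattice.
  have hall : ∀ z, D (2 * z) = 4 * D z := fun z => congrFun
    (Continuous.ext_on L.dense_two_mul_notMem_lattice (by fun_prop) (by fun_prop)
      (fun z hz => h2 z hz)) z
  obtain ⟨M, hM⟩ := (IsZLattice.isCompact_range_of_periodic L.lattice D hD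
    hper).isBounded.exists_norm_le
  have hn : ∀ (n : ℕ) (z : ℂ), D (2 ^ n * z) = 4 ^ n * D z := by
    intro n
    induction n with
    | zero => simp
    | succ n ih => intro z; rw [pow_succ', mul_assoc, hall, ih]; ring
  by_contra hne
  have h0 : 0 < |D z| := abs_pos.2 hne
  obtain ⟨n, hlt⟩ := pow_unbounded_of_one_lt (M / |D z|) (by norm_num : (1 : ℝ) < 4)
  rw [div_lt_iff₀ h0] at hlt
  have := hM (D (2 ^ n * z)) (mem_range_self _)
  rw [hn, Real.norm_eq_abs, abs_mul, abs_of_pos (by positivity : (0 : ℝ) < 4 ^ n)] at this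
  linarith

/-- In the difference of two heights the terms in ℘, ℘' and Δ cancel. Giving it the value c₁ - c₂ at
lattice points makes it continuous, and it is multiplied by 4 under doubling. -/
theorem IsNeronHeight.eq_of_notMem {τ : ℍ} {h₁ h₂ : ℂ → ℝ} (H₁ : IsNeronHeight τ h₁)
    (H₂ : IsNeronHeight τ h₂) {z : ℂ} (hz : z ∉ (periodPair τ).lattice) : h₁ z = h₂ z := by
  classical
  set L := periodPair τ
  obtain ⟨c₁, hc₁⟩ := H₁.limit
  obtain ⟨c₂, hc₂⟩ := H₂.limit
  set D : ℂ → ℝ := fun z => if z ∈ L.lattice then c₁ - c₂ else h₁ z - h₂ z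
  have hDn : ∀ z, z ∉ L.lattice → D z = h₁ z - h₂ z := fun z hz => if_neg hz
  have hDper : ∀ z, ∀ l ∈ L.lattice, D (z + l) = D z := by
    intro z l hl
    simp only [D, add_mem_lattice_iff hl, H₁.periodic z l hl, H₂.periodic z l hl]
  have hD0 : ContinuousAt D 0 := by
    rw [continuousAt_iff_punctured_nhds]
    have : D 0 = c₁ - c₂ := if_pos (zero_mem _)
    rw [this]
    refine (hc₁.sub hc₂).congr' ?_
    filter_upwards [L.eventually_notMem_lattice] with z hz
    rw [hDn z hz]
    ring
  have hD : Continuous D := by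
    refine continuous_iff_continuousAt.2 fun x => ?_
    by_cases hx : x ∈ L.lattice
    · have h0 : ContinuousAt D (x - x) := by rwa [sub_self]
      have h1 : ContinuousAt (fun y => D (y - x)) x :=
        h0.comp (f := fun y : ℂ => y - x) (by fun_prop)
      refine h1.congr (Filter.Eventually.of_forall fun y => ?_)
      simpa using (hDper (y - x) x hx).symm
    · have hU : {z | z ∉ L.lattice} ∈ 𝓝 x := L.isClosed_lattice.isOpen_compl.mem_nhds hx
      refine ((H₁.continuousOn.continuousAt hU).sub (H₂.continuousOn.continuousAt hU)).congr ?_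
      filter_upwards [hU] with y hy using (hDn y hy).symm
  have := L.eq_zero_of_periodic_of_two_mul hD hDper (fun z hz => by
    rw [hDn _ hz, hDn _ (notMem_lattice_of_two_mul hz), H₁.duplication z hz,
      H₂.duplication z hz]
    ring) z
  rw [hDn z hz] at this
  linarith

theorem isNeronHeight_neronHeight (τ : ℍ) : IsNeronHeight τ (neronHeight τ) :=
  Classical.epsilon_spec ⟨_, isNeronHeight_explicitNeronHeight τ⟩

theorem neronHeight_eq_thetaGreen {τ : ℍ} {z : ℂ} (hz : z ∉ (periodPair τ).lattice) :
    neronHeight τ z = thetaGreen τ z := by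
  rw [(isNeronHeight_neronHeight τ).eq_of_notMem (isNeronHeight_explicitNeronHeight τ) hz,
    explicitNeronHeight_of_notMem hz]

end NeronHeight

/-! ### Invariance of the height under the modular group. -/

section Modularity

theorem div_denom_mem_lattice (γ : SL(2, ℤ)) (τ : ℍ) (z : ℂ) :
    z ∈ (periodPair τ).lattice ↔ z / denom γ τ ∈ (periodPair (γ • τ)).lattice := by
  have hd : denom γ τ ≠ 0 := denom_ne_zero _ τ
  have hs := coe_smul_mul_denom γ τ
  have hm := denom_int γ τ
  have hdet : (γ 0 0 * γ 1 1 - γ 0 1 * γ 1 0 : ℂ) = 1 := by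
    have := γ.det_coe
    rw [Matrix.det_fin_two] at this
    exact_mod_cast this
  rw [mem_lattice_periodPair, mem_lattice_periodPair]
  constructor
  · rintro ⟨m, n, rfl⟩
    refine ⟨m * γ 0 0 - n * γ 0 1, n * γ 1 1 - m * γ 1 0, ?_⟩
    rw [div_eq_iff hd, add_mul, mul_assoc (_ : ℂ) _ (denom γ τ), hs, hm]
    push_cast
    linear_combination -(m + n * τ : ℂ) * hdet
  · rintro ⟨m, n, h⟩
    rw [div_eq_iff hd, add_mul, mul_assoc (_ : ℂ) _ (denom γ τ), hs, hm] at h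
    refine ⟨m * γ 1 1 + n * γ 0 1, m * γ 1 0 + n * γ 0 0, ?_⟩
    rw [h]
    push_cast
    ring

theorem latticeDiscr_smul (γ : SL(2, ℤ)) (τ : ℍ) :
    latticeDiscr (γ • τ) = denom γ τ ^ 12 * latticeDiscr τ := by
  have h := PeriodPair.G_scale (denom_ne_zero _ τ) (div_denom_mem_lattice γ τ)
  unfold latticeDiscr PeriodPair.g₂ PeriodPair.g₃
  rw [h 4, h 6]
  ring

/-- With d = cτ + d₀ the denominator, ℘' gains the factor d³ and Δ the factor d¹², so the terms 3
log |d| and (12/4) log |d| cancel in the duplication law. The factor d² of ℘ only shifts the limit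
at 0 by log |d|. Invariance then follows from uniqueness. -/
theorem isNeronHeight_smul (γ : SL(2, ℤ)) (τ : ℍ) :
    IsNeronHeight τ fun z => neronHeight (γ • τ) (z / denom γ τ) := by
  have hd : denom γ τ ≠ 0 := denom_ne_zero _ τ
  have hdn := norm_ne_zero_iff.2 hd
  have hL := div_denom_mem_lattice γ τ
  have H := isNeronHeight_neronHeight (γ • τ)
  refine ⟨fun z l hl => ?_, ?_, ?_, fun z hz => ?_⟩
  · rw [add_div]
    exact H.periodic _ _ ((hL l).1 hl)
  · exact H.continuousOn.comp (by fun_prop) fun z hz h => hz ((hL z).2 h)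
  · obtain ⟨c, hc⟩ := H.limit
    have hmap : Filter.Tendsto (fun z : ℂ => z / denom γ τ) (𝓝[≠] 0) (𝓝[≠] 0) := by
      refine tendsto_nhdsWithin_iff.2 ⟨?_, ?_⟩
      · have : ContinuousAt (fun y : ℂ => y / denom γ τ) 0 := by fun_prop
        simpa using this.tendsto.mono_left nhdsWithin_le_nhds
      · filter_upwards [self_mem_nhdsWithin] with y hy
        exact div_ne_zero hy hd
    refine ⟨c + Real.log ‖denom γ τ‖, ((hc.comp hmap).add_const _).congr' ?_⟩
    -- The logarithm of the product d² ℘(z) splits only where ℘ is nonzero, which holds near its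
    -- pole.
    have h0 : ∀ᶠ z in 𝓝[≠] (0 : ℂ), (periodPair τ).weierstrassP z ≠ 0 := by
      have hE := ((periodPair τ).analyticAt_weierstrassPExcept 0).continuousAt
      have hP : ContinuousAt (fun z => z ^ 2 * (periodPair τ).weierstrassPExcept 0 z + 1) 0 :=
        ((continuousAt_id.pow 2).mul hE).add continuousAt_const
      filter_upwards [self_mem_nhdsWithin, nhdsWithin_le_nhds (hP.eventually_ne
        (by simp : (fun z => z ^ 2 * (periodPair τ).weierstrassPExcept 0 z + 1) 0 ≠ 0))]
        with z hz h2 h3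
      have hz : z ≠ 0 := hz
      have := (periodPair τ).weierstrassPExcept_def 0 z
      simp only [ZeroMemClass.coe_zero, sub_zero] at this
      rw [h3] at this
      apply h2
      rw [this]
      field_simp
      ring
    filter_upwards [h0] with z hz
    simp only [Function.comp_apply]
    rw [PeriodPair.weierstrassP_div hd hL, norm_mul, norm_pow,
      Real.log_mul (pow_ne_zero 2 hdn) (norm_ne_zero_iff.2 hz), Real.log_pow]
    push_cast
    ring
  · have h2 : 2 * (z / denom γ τ) ∉ (periodPair (γ • τ)).lattice := by
      rw [← mul_div_assoc]
      exact fun h => hz ((hL _).2 h)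
    have h3 := norm_ne_zero_iff.2 (derivWeierstrassP_ne_zero hz)
    rw [mul_div_assoc, H.duplication _ h2, PeriodPair.derivWeierstrassP_div hd hL,
      latticeDiscr_smul, norm_mul, norm_mul, norm_pow, norm_pow,
      Real.log_mul (pow_ne_zero 3 hdn) h3,
      Real.log_mul (pow_ne_zero 12 hdn) (norm_latticeDiscr_pos τ).ne', Real.log_pow, Real.log_pow]
    push_cast
    ring

theorem neronHeight_smul (γ : SL(2, ℤ)) {τ : ℍ} {z : ℂ} (hz : z ∉ (periodPair τ).lattice) :
    neronHeight (γ • τ) (z / denom γ τ) = neronHeight τ z :=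
  (isNeronHeight_smul γ τ).eq_of_notMem (isNeronHeight_neronHeight τ) hz

theorem add_add_mul_mem_lattice_iff {τ : ℍ} {z : ℂ} (m n : ℤ) :
    z + m + n * (τ : ℂ) ∈ (periodPair τ).lattice ↔ z ∈ (periodPair τ).lattice := by
  rw [add_assoc]
  exact add_mem_lattice_iff ((mem_lattice_periodPair).2 ⟨m, n, rfl⟩)

theorem ModularFamily.mk_eq_mk {k : ℕ} {p q : ℍ × ℂ} :
    ModularFamily.mk k p = ModularFamily.mk k q ↔ ModularRel k p q :=
  Quotient.eq (r := ⟨ModularRel k, modularRel_equivalence k⟩)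

theorem ModularRel.mem_lattice_iff {k : ℕ} {p q : ℍ × ℂ} (h : ModularRel k p q) :
    p.2 ∈ (periodPair p.1).lattice ↔ q.2 ∈ (periodPair q.1).lattice := by
  obtain ⟨γ, -, m, n, h1, h2⟩ := h
  rw [h1, h2, ← div_denom_mem_lattice, add_add_mul_mem_lattice_iff]

theorem ModularFamily.mk_mem_zeroSection {k : ℕ} {τ : ℍ} {z : ℂ} :
    ModularFamily.mk k (τ, z) ∈ ModularFamily.zeroSection k ↔ z ∈ (periodPair τ).lattice := by
  constructor
  · rintro ⟨σ, h⟩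
    exact (ModularFamily.mk_eq_mk.1 h).mem_lattice_iff.1 (zero_mem _)
  · intro h
    obtain ⟨m, n, h⟩ := mem_lattice_periodPair.1 h
    refine ⟨τ, ModularFamily.mk_eq_mk.2 ⟨1, one_mem _, m, n, by simp, ?_⟩⟩
    rw [denom_int, h]
    simp

theorem ModularRel.neronHeight_eq {k : ℕ} {p q : ℍ × ℂ} (h : ModularRel k p q)
    (hp : p.2 ∉ (periodPair p.1).lattice) : neronHeight p.1 p.2 = neronHeight q.1 q.2 := by
  obtain ⟨γ, -, m, n, h1, h2⟩ := h
  rw [h1, h2, neronHeight_smul γ (by rwa [add_add_mul_mem_lattice_iff]), add_assoc,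
    (isNeronHeight_neronHeight _).periodic _ _ (mem_lattice_periodPair.2 ⟨m, n, rfl⟩)]

theorem ModularFamily.neronHeight_mk {k : ℕ} {τ : ℍ} {z : ℂ} (hz : z ∉ (periodPair τ).lattice) :
    (ModularFamily.mk k (τ, z)).neronHeight = thetaGreen τ z := by
  have h : ModularRel k (Quotient.out (ModularFamily.mk k (τ, z))) (τ, z) :=
    ModularFamily.mk_eq_mk.1 (Quotient.out_eq _)
  exact (h.neronHeight_eq (mt h.mem_lattice_iff.1 hz)).trans (neronHeight_eq_thetaGreen hz)

end Modularity

/-! ### The normalized theta function. -/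

section SiegelTheta

/-- The theta function `oddTheta`, multiplied by the factor which makes its norm compatible with
the Néron local height. -/
def normalizedTheta (p : ℂ × ℂ) : ℂ :=
  expTwoPiI (p.1 / 12) * oddTheta p.1 p.2

theorem differentiableOn_normalizedTheta :
    DifferentiableOn ℂ normalizedTheta {p | 0 < p.1.im} := by
  have h : Differentiable ℂ fun p : ℂ × ℂ => expTwoPiI (p.1 / 12) :=
    differentiable_expTwoPiI.comp (by fun_prop : Differentiable ℂ fun p : ℂ × ℂ => p.1 / 12)
  exact h.differentiableOn.mul differentiableOn_oddTheta

theorem normalizedTheta_eq_zero_iff (τ : ℍ) (z : ℂ) :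
    normalizedTheta (τ, z) = 0 ↔ z ∈ (periodPair τ).lattice := by
  simp [normalizedTheta, expTwoPiI_ne_zero, oddTheta_eq_zero_iff]

theorem hasDerivAt_normalizedTheta (τ : ℍ) (z : ℂ) : HasDerivAt (fun z => normalizedTheta (τ, z))
    (expTwoPiI (τ / 12) * deriv (oddTheta τ) z) z := by
  exact ((differentiable_oddTheta τ.im_pos) z).hasDerivAt.const_mul (expTwoPiI (τ / 12))

/-- Since |e(τ/12)| = exp(-π Im τ / 6), the additive constant is absorbed into a holomorphic factor
without zeros and so does not affect dd^c. -/
theorem thetaGreen_eq_normalizedTheta {τ : ℍ} {z : ℂ} (hz : z ∉ (periodPair τ).lattice) :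
    thetaGreen τ z = Real.pi * (z.im ^ 2 / τ.im) - Real.log ‖normalizedTheta (τ, z)‖ := by
  have h : ((τ : ℂ) / 12).im = τ.im / 12 := by
    simp
  unfold thetaGreen normalizedTheta
  rw [norm_mul, norm_expTwoPiI, Real.log_mul (Real.exp_pos _).ne'
    (norm_ne_zero_iff.2 (oddTheta_ne_zero hz)), Real.log_exp]
  dsimp only
  rw [h]
  ring

theorem isLocalEquation_normalizedTheta (τ : ℍ) (W : Set ℂ) :
    IsLocalEquation W (periodPair τ).lattice fun z => normalizedTheta (τ, z) where
  holo z _ := (hasDerivAt_normalizedTheta τ z).differentiableAt.differentiableWithinAt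
  zero_iff z _ := normalizedTheta_eq_zero_iff τ z
  order_one z _ hz h := by
    have h1 := hasDerivAt_normalizedTheta τ z
    have h2 := h1.hasFDerivAt.fderiv
    rw [h] at h2
    have h3 := congrArg (fun T : ℂ →L[ℂ] ℂ => T 1) h2
    simp only [ContinuousLinearMap.toSpanSingleton_apply, one_smul, zero_apply] at h3
    exact mul_ne_zero (expTwoPiI_ne_zero _)
      (deriv_oddTheta_ne_zero ((normalizedTheta_eq_zero_iff τ z).1 hz)) h3.symm

end SiegelTheta

/-! ### Restriction to a fibre and the normalized Haar measure. -/

section Fibre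

theorem muForm_fibre (τ : ℍ) (z : ℂ) : muForm (τ, z) (0, 1) (0, Complex.I) = τ.im⁻¹ := by
  have hp : 0 < ((τ : ℂ), z).1.im := τ.im_pos
  rw [muForm_eq_wedgeDiff hp, wedgeDiff, fderiv_betti₁ hp, fderiv_betti₁ hp, fderiv_betti₂ hp,
    fderiv_betti₂ hp]
  simp

/-- `potential_current` applied to the fibre inclusion z ↦ (τ, z), along which μ has density 1 / Im
τ. -/
theorem fibre_current (τ : ℍ) {W : Set ℂ} (hW : IsOpen W) {s : ℂ → ℂ}
    (hs : IsLocalEquation W (periodPair τ).lattice s) {p : ℂ → ℝ}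
    (hp : ∀ z, z ∉ (periodPair τ).lattice → p z = thetaGreen τ z) {g : ℂ → ℝ}
    (hg : IsTestFunction W g) :
    ddcCurrent W (fun z => p z + Real.log ‖s z‖) 1 Complex.I g = ∫ z, g z ∂fibreHaar τ := by
  have hA : ∀ z : ℂ, HasFDerivAt (fun z : ℂ => ((τ : ℂ), z)) (ContinuousLinearMap.inr ℝ ℂ ℂ) z :=
    fun z => hasFDerivAt_prodMk_right _ _
  rw [(potential_current hW (A := fun z => ((τ : ℂ), z)) (by fun_prop) (fun _ _ => τ.im_pos) hs
    (isLocalEquation_normalizedTheta τ W) (p := fun z => p z + Real.log ‖s z‖)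
    fun z _ hz => by rw [hp z hz, thetaGreen_eq_normalizedTheta hz]; rfl).2 1 Complex.I g hg]
  simp only [(hA _).fderiv, ContinuousLinearMap.inr_apply, muForm_fibre]
  rw [setIntegral_eq_integral_of_forall_compl_eq_zero, integral_const_mul, fibreHaar,
    integral_smul_measure, ENNReal.toReal_inv, ENNReal.toReal_ofReal τ.im_pos.le, smul_eq_mul]
  intro z hz
  rw [image_eq_zero_of_notMem_tsupport fun h => hz (hg.2.2 h), mul_zero]

theorem exists_isTestFunction_integral_ne_zero (τ : ℍ) {W : Set ℂ} {z : ℂ} (hW : W ∈ 𝓝 z) :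
    ∃ g : ℂ → ℝ, IsTestFunction W g ∧ ∫ z, g z ∂fibreHaar τ ≠ 0 := by
  obtain ⟨g, hg1, hg2, hg3, hg4, hg5⟩ := exists_contDiff_tsupport_subset (n := ⊤) hW
  refine ⟨g, ⟨hg3, hg2, hg1⟩, ?_⟩
  have hpos : 0 < ∫ z, g z := hg3.continuous.integral_pos_of_hasCompactSupport_nonneg_nonzero hg2
    (fun x => (hg4 (mem_range_self x)).1) (x := z) (by rw [hg5]; exact one_ne_zero)
  rw [fibreHaar, integral_smul_measure, ENNReal.toReal_inv, ENNReal.toReal_ofReal τ.im_pos.le]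
  exact (smul_pos (inv_pos.2 τ.im_pos) hpos).ne'

end Fibre

/-! ### Openness of a holomorphic map where its differential is surjective. -/

section OpenMapping

variable {B E : Type*} [TopologicalSpace B] [ChartedSpace ℂ B] [IsManifold 𝓘(ℂ) ω B]
  [TopologicalSpace E] [ChartedSpace (ℂ × ℂ) E] [IsManifold 𝓘(ℂ, ℂ × ℂ) ω E]

/-- The open mapping property of a strictly differentiable map with surjective derivative, read in
charts. It supplies open sets of regular values over which the inverse of the classifying
isomorphism can be used. -/
theorem MDifferentiable.image_mem_nhds_of_surjective {π : E → B}
    (hπ : MDifferentiable 𝓘(ℂ, ℂ × ℂ) 𝓘(ℂ) π) {e : E}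
    (he : Function.Surjective (mfderiv 𝓘(ℂ, ℂ × ℂ) 𝓘(ℂ) π e)) {S : Set E} (hS : S ∈ 𝓝 e) :
    π '' S ∈ 𝓝 (π e) := by
  have : IsManifold 𝓘(ℂ) 1 B := IsManifold.of_le (n := ω) le_top
  have : IsManifold 𝓘(ℂ, ℂ × ℂ) 1 E := IsManifold.of_le (n := ω) le_top
  set φ := extChartAt 𝓘(ℂ, ℂ × ℂ) e
  set ψ := extChartAt 𝓘(ℂ) (π e)
  set P : ℂ × ℂ → ℂ := ψ ∘ π ∘ φ.symm
  set W : Set (ℂ × ℂ) := φ.target ∩ φ.symm ⁻¹' (π ⁻¹' ψ.source)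
  have hWo : IsOpen W := (continuousOn_extChartAt_symm e).isOpen_inter_preimage
    (isOpen_extChartAt_target e) ((isOpen_extChartAt_source (π e)).preimage hπ.continuous)
  have hPd : DifferentiableOn ℂ P W := by
    have h := (mdifferentiableOn_iff.1 (hπ.mdifferentiableOn (s := univ))).2 e (π e)
    simpa only [univ_inter] using h
  have hx : φ e ∈ W := ⟨mem_extChartAt_target e, by
    change π (φ.symm (φ e)) ∈ ψ.source
    rw [φ.left_inv (mem_extChartAt_source e)]
    exact mem_extChartAt_source (π e)⟩
  have hstrict : HasStrictFDerivAt P (fderiv ℂ P (φ e)) (φ e) :=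
    ((hPd.contDiffOn_complex hWo).contDiffAt (hWo.mem_nhds hx)).hasStrictFDerivAt (by simp)
  have hrange : (fderiv ℂ P (φ e)).range = ⊤ := by
    rw [(hπ e).mfderiv] at he
    simp only [ModelWithCorners.range_eq_univ, fderivWithin_univ] at he
    exact LinearMap.range_eq_top.2 he
  have hmap := hstrict.map_nhds_eq_of_surj hrange
  have hT : φ.symm ⁻¹' S ∩ W ∈ 𝓝 (φ e) := by
    refine Filter.inter_mem ?_ (hWo.mem_nhds hx)
    refine (continuousAt_extChartAt_symm e).preimage_mem_nhds ?_
    rwa [extChartAt_to_inv]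
  have hPT : P '' (φ.symm ⁻¹' S ∩ W) ∈ 𝓝 (ψ (π e)) := by
    have h := Filter.image_mem_map (m := P) hT
    rw [hmap] at h
    have h2 : P (φ e) = ψ (π e) := by
      change ψ (π (φ.symm (φ e))) = _
      rw [φ.left_inv (mem_extChartAt_source e)]
    rwa [h2] at h
  filter_upwards [(continuousAt_extChartAt (π e)).preimage_mem_nhds hPT,
    extChartAt_source_mem_nhds (I := 𝓘(ℂ)) (π e)] with b hb hbs
  obtain ⟨x, ⟨hxS, hxW⟩, hxb⟩ := hb
  exact ⟨φ.symm x, hxS, ψ.injOn hxW.2 hbs hxb⟩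

end OpenMapping

/-! ### The elliptic surface: normalizing constant, local equation of the zero section, main
theorem. -/

section Surface

variable {B E : Type*} [TopologicalSpace B] [ChartedSpace ℂ B]
  [TopologicalSpace E] [ChartedSpace (ℂ × ℂ) E] {k : ℕ} {π : E → B} (C : ClassifyingMap k π)

theorem ClassifyingMap.mem_zeroSection {e : E} (he : e ∈ regularPart π) :
    e ∈ C.zeroSection ↔ C.fSharp e ∈ ModularFamily.zeroSection k :=
  and_iff_right he

namespace ClassifyingMap

theorem isNormalizing_one : C.IsNormalizing 1 := by
  intro b hb τ u hu W s hW hs g hg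
  have hZ : u ⁻¹' C.zeroSection = (periodPair τ).lattice := by
    ext z
    have hreg : u z ∈ regularPart π := by
      change π (u z) ∈ regularBase π
      rwa [(hu z).1]
    rw [mem_preimage, C.mem_zeroSection hreg, (hu z).2, ModularFamily.mk_mem_zeroSection]
    rfl
  rw [hZ] at hs
  rw [one_mul]
  refine fibre_current τ hW hs (fun z hz => ?_) hg
  rw [ClassifyingMap.neronHeight, (hu z).2, ModularFamily.neronHeight_mk hz]

/-- Without a regular fibre every constant would be normalizing; `C.nonconstant` provides one. -/
theorem exists_fibre_parametrization : ∃ b ∈ regularBase π, ∃ (τ : ℍ) (u : ℂ → E),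
    ∀ z, π (u z) = b ∧ C.fSharp (u z) = ModularFamily.mk k (τ, z) := by
  obtain ⟨b, hb, -⟩ := C.nonconstant
  obtain ⟨τ, hτ⟩ := Quotient.exists_rep (C.f b)
  choose u hu using fun z => (C.bijective b hb (ModularFamily.mk k (τ, z)) hτ).exists
  exact ⟨b, hb, τ, u, hu⟩

theorem IsNormalizing.eq_one {c : ℝ} (hc : C.IsNormalizing c) : c = 1 := by
  obtain ⟨b, hb, τ, u, hu⟩ := C.exists_fibre_parametrization
  have hWo : IsOpen {z | z ∉ (periodPair τ).lattice} :=
    (periodPair τ).isClosed_lattice.isOpen_compl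
  obtain ⟨g, hg, hint⟩ := exists_isTestFunction_integral_ne_zero τ
    (hWo.mem_nhds (one_half_notMem_lattice τ))
  -- To determine the constant it suffices to test away from the zero section, where 1 is a local
  -- equation.
  have hs : IsLocalEquation {z | z ∉ (periodPair τ).lattice} (u ⁻¹' C.zeroSection)
      fun _ => (1 : ℂ) := by
    refine ⟨differentiableOn_const _, fun z hz => ?_, fun z _ h => absurd h one_ne_zero⟩
    refine ⟨fun h => absurd h one_ne_zero, fun h => absurd h.2 ?_⟩
    rw [(hu z).2, ModularFamily.mk_mem_zeroSection]
    exact hz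
  have h1 := C.isNormalizing_one b hb τ u hu _ _ hWo hs g hg
  have h2 := hc b hb τ u hu _ _ hWo hs g hg
  rw [one_mul] at h1
  rw [h1] at h2
  exact mul_right_cancel₀ hint (h2.trans (one_mul _).symm)

theorem existsUnique_isNormalizing : ∃! c : ℝ, C.IsNormalizing c :=
  ⟨1, C.isNormalizing_one, fun _ hc => hc.eq_one⟩

theorem normalizingConstant_eq_one : C.normalizingConstant = 1 :=
  IsNormalizing.eq_one C (Classical.epsilon_spec ⟨1, C.isNormalizing_one⟩)

end ClassifyingMap

section Chart

variable {C} {φ : OpenPartialHomeomorph E (ℂ × ℂ)} {F : ℂ × ℂ → ℂ × ℂ}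

theorem ClassifyingMap.IsEllipticLog.mem_zeroSection_iff (hF : C.IsEllipticLog φ F)
    (hφ : φ.source ⊆ regularPart π) {x : ℂ × ℂ} (hx : x ∈ φ.target) :
    φ.symm x ∈ C.zeroSection ↔ normalizedTheta (F x) = 0 := by
  obtain ⟨h, hl⟩ := hF.lift x hx
  have h1 : φ.symm x ∈ regularPart π := hφ (φ.map_target hx)
  rw [C.mem_zeroSection h1, hl, ModularFamily.mk_mem_zeroSection]
  exact (normalizedTheta_eq_zero_iff ⟨(F x).1, h⟩ (F x).2).symm

/-- The logarithm of the norm of `normalizedTheta` and the Néron local height have the same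
singularities. -/
theorem ClassifyingMap.IsEllipticLog.neronHeight_eq (hF : C.IsEllipticLog φ F) {x : ℂ × ℂ}
    (hx : x ∈ φ.target) (hne : normalizedTheta (F x) ≠ 0) :
    C.neronHeight (φ.symm x) =
      Real.pi * ((F x).2.im ^ 2 / (F x).1.im) - Real.log ‖normalizedTheta (F x)‖ := by
  obtain ⟨h, hl⟩ := hF.lift x hx
  have hn : (F x).2 ∉ (periodPair ⟨(F x).1, h⟩).lattice := fun hm =>
    hne ((normalizedTheta_eq_zero_iff ⟨(F x).1, h⟩ (F x).2).2 hm)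
  rw [ClassifyingMap.neronHeight, hl, ModularFamily.neronHeight_mk hn,
    thetaGreen_eq_normalizedTheta hn]
  rfl

variable [IsManifold 𝓘(ℂ) ω B] [IsManifold 𝓘(ℂ, ℂ × ℂ) ω E]

/-- Near a point of the zero section, the fibre has a holomorphic parametrization by the elliptic
logarithm. -/
theorem ClassifyingMap.IsEllipticLog.exists_fibre (hF : C.IsEllipticLog φ F)
    (hπ : MDifferentiable 𝓘(ℂ, ℂ × ℂ) 𝓘(ℂ) π)
    (hφm : φ ∈ IsManifold.maximalAtlas 𝓘(ℂ, ℂ × ℂ) ω E) (hφ : φ.source ⊆ regularPart π)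
    {x : ℂ × ℂ} (hx : x ∈ φ.target) (h0 : normalizedTheta (F x) = 0) :
    ∃ (τ : ℍ) (G : ℂ → ℂ × ℂ), G 0 = x ∧ DifferentiableAt ℂ G 0 ∧
      ∀ᶠ z in 𝓝 0, G z ∈ φ.target ∧ C.fSharp (φ.symm (G z)) = ModularFamily.mk k (τ, z) := by
  have : IsManifold 𝓘(ℂ) 1 B := IsManifold.of_le (n := ω) le_top
  have : IsManifold 𝓘(ℂ, ℂ × ℂ) 1 E := IsManifold.of_le (n := ω) le_top
  set e := φ.symm x
  have he : e ∈ φ.source := φ.map_target hx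
  have hreg : e ∈ regularPart π := hφ he
  obtain ⟨U, hU, heU, τ, hτ, hfτ⟩ := C.f_holo (π e) hreg
  obtain ⟨V, hVs, hV, heV⟩ := mem_nhds_iff.1 (hπ.image_mem_nhds_of_surjective (hreg e rfl)
    (φ.open_source.mem_nhds he))
  have hVreg : V ⊆ regularBase π := by
    rintro _ hb
    obtain ⟨y, hy, rfl⟩ := hVs hb
    exact hφ hy
  obtain ⟨g, hg, hgl⟩ := C.inverse_holo (U ∩ V) τ (hU.inter hV)
    (inter_subset_right.trans hVreg) (hτ.mono inter_subset_left) fun y hy => hfτ y hy.1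
  have hbUV : π e ∈ U ∩ V := ⟨heU, heV⟩
  -- The point of the zero section over a given point of the modular curve does not depend on the
  -- representative in ℍ, because the group preserves z = 0.
  have hzero : C.fSharp e = ModularFamily.mk k (τ (π e), 0) := by
    obtain ⟨σ, hσ⟩ := ((hF.mem_zeroSection_iff hφ hx).2 h0).2
    have hproj := C.proj_fSharp e hreg
    have hσ : ModularFamily.mk k (σ, 0) = C.fSharp e := hσ
    rw [← hσ, hfτ _ heU] at hproj
    obtain ⟨γ, hγ⟩ : ∃ γ : CongruenceSubgroup.Gamma k, γ • τ (π e) = σ := Quotient.exact hproj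
    rw [← hσ]
    refine (ModularFamily.mk_eq_mk.2 ⟨γ, γ.2, 0, 0, hγ.symm, ?_⟩).symm
    simp
  -- Both points lie over π e and have the same image in the modular family, so they agree by
  -- injectivity of the classifying isomorphism.
  have hg0 : g (π e, 0) = e :=
    (C.bijective (π e) hreg _ (C.proj_fSharp e hreg)).unique
      ⟨(hgl _ hbUV 0).1, (hgl _ hbUV 0).2.trans hzero.symm⟩ ⟨rfl, rfl⟩
  have hgd : MDifferentiableAt 𝓘(ℂ) 𝓘(ℂ, ℂ × ℂ) (fun z : ℂ => g (π e, z)) 0 := by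
    have h1 : MDifferentiableAt (𝓘(ℂ).prod 𝓘(ℂ)) 𝓘(ℂ, ℂ × ℂ) g (π e, 0) :=
      hg.mdifferentiableAt (((hU.inter hV).prod isOpen_univ).mem_nhds ⟨hbUV, mem_univ _⟩)
    have h2 : MDifferentiableAt 𝓘(ℂ) (𝓘(ℂ).prod 𝓘(ℂ)) (fun z : ℂ => (π e, z)) 0 :=
      mdifferentiableAt_const.prodMk mdifferentiableAt_id
    exact h1.comp (f := fun z : ℂ => (π e, z)) 0 h2
  have hφd : MDifferentiableAt 𝓘(ℂ, ℂ × ℂ) 𝓘(ℂ, ℂ × ℂ) φ (g (π e, 0)) := by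
    rw [hg0]
    exact (contMDiffAt_of_mem_maximalAtlas hφm he).mdifferentiableAt (by simp)
  refine ⟨τ (π e), fun z => φ (g (π e, z)), ?_, ?_, ?_⟩
  · simp only [hg0]
    exact φ.right_inv hx
  · exact mdifferentiableAt_iff_differentiableAt.1
      (hφd.comp (f := fun z : ℂ => g (π e, z)) 0 hgd)
  · have hmem : ∀ᶠ z in 𝓝 (0 : ℂ), g (π e, z) ∈ φ.source :=
      hgd.continuousAt.eventually_mem (φ.open_source.mem_nhds (by rwa [hg0]))
    filter_upwards [hmem] with z hz
    exact ⟨φ.map_source hz, by rw [φ.left_inv hz, (hgl _ hbUV z).2]⟩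

/-- Only the order of vanishing needs an argument. Along a fibre curve G on which z is the elliptic
logarithm, both Θ(τ, z) and Θ(F(G z)) compute the same height, so their moduli differ by a
continuous positive factor. If d(Θ ∘ F) vanished at x, then Θ(τ, z) would be o(z), contradicting its
simple zero at 0. -/
theorem ClassifyingMap.IsEllipticLog.isLocalEquation_normalizedTheta (hF : C.IsEllipticLog φ F)
    (hπ : MDifferentiable 𝓘(ℂ, ℂ × ℂ) 𝓘(ℂ) π)
    (hφm : φ ∈ IsManifold.maximalAtlas 𝓘(ℂ, ℂ × ℂ) ω E) (hφ : φ.source ⊆ regularPart π) :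
    IsLocalEquation φ.target (φ.symm ⁻¹' C.zeroSection) fun x => normalizedTheta (F x) := by
  have hpos : ∀ x ∈ φ.target, 0 < (F x).1.im := fun x hx => (hF.lift x hx).1
  have hd : DifferentiableOn ℂ (fun x => normalizedTheta (F x)) φ.target :=
    differentiableOn_normalizedTheta.comp hF.holo fun x hx => hpos x hx
  refine ⟨hd, fun x hx => (hF.mem_zeroSection_iff hφ hx).symm, fun x hx h0 hder => ?_⟩
  obtain ⟨τ, G, hG0, hGd, hG⟩ := hF.exists_fibre hπ hφm hφ hx h0
  have hxn : φ.target ∈ 𝓝 x := φ.open_target.mem_nhds hx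
  have hFc : ContinuousAt (fun z => F (G z)) 0 :=
    ContinuousAt.comp (f := G) (g := F)
      (by rw [hG0]; exact (hF.holo.differentiableAt hxn).continuousAt) hGd.continuousAt
  -- This factor is the exponential of the difference of the quadratic terms in the two formulas for
  -- the height.
  have hcoef : ContinuousAt (fun z : ℂ => Real.exp (Real.pi * (z.im ^ 2 / τ.im) -
      Real.pi * ((F (G z)).2.im ^ 2 / (F (G z)).1.im))) 0 := by
    have h1 : ContinuousAt (fun z => (F (G z)).2.im ^ 2 / (F (G z)).1.im) 0 := by
      have h2 : ContinuousAt (fun z => (F (G z)).2.im) 0 :=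
        Complex.continuous_im.continuousAt.comp (continuous_snd.continuousAt.comp hFc)
      have h3 : ContinuousAt (fun z => (F (G z)).1.im) 0 :=
        Complex.continuous_im.continuousAt.comp (continuous_fst.continuousAt.comp hFc)
      refine (h2.pow 2).div h3 ?_
      rw [hG0]
      exact (hpos x hx).ne'
    have h4 : ContinuousAt (fun z : ℂ => Real.pi * (z.im ^ 2 / τ.im)) 0 := by fun_prop
    exact (h4.sub (h1.const_mul _)).rexp
  have hsmall : (fun z => normalizedTheta (F (G z))) =o[𝓝 0] fun z : ℂ => z := by
    have h1 : HasFDerivAt (fun x => normalizedTheta (F x)) (0 : ℂ × ℂ →L[ℂ] ℂ) x :=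
      hder ▸ (hd.differentiableAt hxn).hasFDerivAt
    have h2 : (fun y => normalizedTheta (F y)) =o[𝓝 x] fun y => y - x := by
      simpa [h0] using h1.isLittleO
    have h3 : Filter.Tendsto G (𝓝 0) (𝓝 x) := by
      simpa [hG0] using hGd.continuousAt.tendsto
    have h4 : (fun z => G z - x) =O[𝓝 0] fun z : ℂ => z := by
      simpa [hG0] using hGd.isBigO_sub
    exact (h2.comp_tendsto h3).trans_isBigO h4
  have hcmp : ∀ᶠ z in 𝓝 (0 : ℂ), ‖normalizedTheta (τ, z)‖ =
      Real.exp (Real.pi * (z.im ^ 2 / τ.im) -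
        Real.pi * ((F (G z)).2.im ^ 2 / (F (G z)).1.im)) * ‖normalizedTheta (F (G z))‖ := by
    have hoff : ∀ᶠ z in 𝓝 (0 : ℂ), z ≠ 0 → z ∉ (periodPair τ).lattice :=
      eventually_nhdsWithin_iff.1 (periodPair τ).eventually_notMem_lattice
    filter_upwards [hG, hoff] with z ⟨hzt, hz⟩ hzL
    -- At z = 0 the height formula does not apply, but both theta values vanish there.
    by_cases hz0 : z = 0
    · subst hz0
      rw [hG0, h0, (normalizedTheta_eq_zero_iff τ 0).2 (zero_mem _)]
      simp
    · have hzL := hzL hz0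
      have hne1 : normalizedTheta (τ, z) ≠ 0 := fun h =>
        hzL ((normalizedTheta_eq_zero_iff τ z).1 h)
      have hne2 : normalizedTheta (F (G z)) ≠ 0 := fun h => by
        have h1 := ((hF.mem_zeroSection_iff hφ hzt).2 h).2
        rw [hz, ModularFamily.mk_mem_zeroSection] at h1
        exact hzL h1
      have h1 := hF.neronHeight_eq hzt hne2
      rw [ClassifyingMap.neronHeight, hz, ModularFamily.neronHeight_mk hzL,
        thetaGreen_eq_normalizedTheta hzL] at h1
      rw [← Real.exp_log (norm_pos_iff.2 hne1), ← Real.exp_log (norm_pos_iff.2 hne2),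
        ← Real.exp_add]
      congr 1
      linear_combination -h1
  have hbig : (fun z => normalizedTheta (τ, z)) =O[𝓝 0] fun z => normalizedTheta (F (G z)) := by
    refine Asymptotics.IsBigO.of_norm_left ?_
    refine Asymptotics.IsBigO.congr' (f₁ := fun z : ℂ => Real.exp (Real.pi * (z.im ^ 2 / τ.im) -
        Real.pi * ((F (G z)).2.im ^ 2 / (F (G z)).1.im)) * ‖normalizedTheta (F (G z))‖) ?_
      (hcmp.mono fun z hz => hz.symm) Filter.EventuallyEq.rfl
    have h1 := (hcoef.tendsto.isBigO_one ℝ).mul (Asymptotics.isBigO_refl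
      (fun z => ‖normalizedTheta (F (G z))‖) (𝓝 0))
    simp only [one_mul] at h1
    exact h1.of_norm_right
  have hθ : HasDerivAt (fun z => normalizedTheta (τ, z)) 0 0 := by
    rw [hasDerivAt_iff_isLittleO]
    simpa [(normalizedTheta_eq_zero_iff τ 0).2 (zero_mem _)] using hbig.trans_isLittleO hsmall
  exact mul_ne_zero (expTwoPiI_ne_zero _) (deriv_oddTheta_zero_ne_zero τ.im_pos)
    ((hasDerivAt_normalizedTheta τ 0).unique hθ)

end Chart

theorem wedgeDiff_comp {a b : ℂ × ℂ → ℝ} {F : ℂ × ℂ → ℂ × ℂ} {x : ℂ × ℂ}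
    (ha : DifferentiableAt ℝ a (F x)) (hb : DifferentiableAt ℝ b (F x))
    (hF : DifferentiableAt ℝ F x) (v w : ℂ × ℂ) :
    wedgeDiff (fun y => a (F y)) (fun y => b (F y)) x v w =
      wedgeDiff a b (F x) (fderiv ℝ F x v) (fderiv ℝ F x w) := by
  unfold wedgeDiff
  rw [fderiv_fun_comp x ha hF, fderiv_fun_comp x hb hF]
  rfl

end Surface

theorem mainTheorem5 {B E : Type*}
    [TopologicalSpace B] [T2Space B] [CompactSpace B] [ConnectedSpace B]
    [ChartedSpace ℂ B] [IsManifold 𝓘(ℂ) ω B]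
    [TopologicalSpace E] [T2Space E] [CompactSpace E] [ConnectedSpace E]
    [ChartedSpace (ℂ × ℂ) E] [IsManifold 𝓘(ℂ, ℂ × ℂ) ω E]
    (π : E → B) (hπ : MDifferentiable 𝓘(ℂ, ℂ × ℂ) 𝓘(ℂ) π) (hsurj : Function.Surjective π)
    (k : ℕ) (hk : 3 ≤ k) (C : ClassifyingMap k π) :
    (∃! c : ℝ, C.IsNormalizing c) ∧
    ∀ φ ∈ IsManifold.maximalAtlas 𝓘(ℂ, ℂ × ℂ) ω E, φ.source ⊆ regularPart π →
    ∀ F : ℂ × ℂ → ℂ × ℂ, C.IsEllipticLog φ F →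
    ∀ s : ℂ × ℂ → ℂ, IsLocalEquation φ.target (φ.symm ⁻¹' C.zeroSection) s →
      LocallyIntegrableOn (C.potential φ s) φ.target ∧
      ∀ (v w : ℂ × ℂ) (g : ℂ × ℂ → ℝ), IsTestFunction φ.target g →
        C.deMarcoMavrakiCurrent φ s v w g =
          formCurrent φ.target (ClassifyingMap.pullbackMu F) v w g ∧
        C.deMarcoMavrakiCurrent φ s v w g =
          formCurrent φ.target
            (wedgeDiff (fun x => betti₁ (F x)) (fun x => betti₂ (F x))) v w g := by
  have : (volume : Measure (ℂ × ℂ)).IsAddHaarMeasure :=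
    inferInstanceAs (Measure.IsAddHaarMeasure (Measure.prod volume volume))
  refine ⟨C.existsUnique_isNormalizing, fun φ hφm hφ F hF s hs => ?_⟩
  have hpos : ∀ x ∈ φ.target, 0 < (F x).1.im := fun x hx => (hF.lift x hx).1
  -- The smooth comparison function uses Θ ∘ F as second local equation; it is valid only off the
  -- zero section, a null set.
  obtain ⟨hint, hcur⟩ := potential_current φ.open_target hF.holo hpos hs
    (hF.isLocalEquation_normalizedTheta hπ hφm hφ) (p := C.potential φ s) fun x hx hxZ => by
      rw [ClassifyingMap.potential,
        hF.neronHeight_eq hx fun h => hxZ ((hF.mem_zeroSection_iff hφ hx).2 h)]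
  refine ⟨hint, fun v w g hg => ?_⟩
  have hmu : C.deMarcoMavrakiCurrent φ s v w g =
      formCurrent φ.target (ClassifyingMap.pullbackMu F) v w g := by
    rw [ClassifyingMap.deMarcoMavrakiCurrent, C.normalizingConstant_eq_one, one_mul,
      hcur v w g hg]
    rfl
  refine ⟨hmu, hmu.trans (setIntegral_congr_fun φ.open_target.measurableSet fun x hx => ?_)⟩
  have hFx : DifferentiableAt ℝ F x :=
    (hF.holo.differentiableAt (φ.open_target.mem_nhds hx)).restrictScalars ℝ
  rw [wedgeDiff_comp ((contDiffAt_betti₁ (hpos x hx)).differentiableAt (by simp))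
    ((contDiffAt_betti₂ (hpos x hx)).differentiableAt (by simp)) hFx,
    ← muForm_eq_wedgeDiff (hpos x hx)]
  rfl

end
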